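/- Let $\mathcal S$ be the set of sequences $s_1\ge s_2\ge\dots\ge 0$ with finite sum, $\mathcal S_1=\{\mathbf s\in\mathcal S:\sum_i s_i=1\}$, $\mathbf 1=(1,0,0,\dots)$ and $\mathbf 0=(0,0,\dots)$. Let $\alpha<0$ and let $\nu$ be a probability measure on $\mathcal S_1$ with $\nu(\{\mathbf 1\})=0$. Let $(F(t))_{t\ge 0}$ be the self-similar fragmentation process with parameters $(\alpha,\nu)$ started from a single block of mass $1$: blocks evolve independently, and a block of mass $m$ splits after an exponential time of mean $m^{-\alpha}$ into sub-blocks of masses $m\mathbf S$, where $\mathbf S$ has law $\nu$; $F(t)\in\mathcal S$ is the decreasing sequence of the masses of the blocks present at time $t$. Let $\zeta=\inf\{t\ge0:F(t)=\mathbf 0\}$ be the extinction time and $F_\zeta(x)=\mathbb P(\zeta\le x)$. Almost surely, for every $t<\zeta$ there is a unique block present at time $t$ whose descendants become extinct exactly at time $\zeta$; let $F_*(t)$ be its mass, and $F_*(t)=0$ for $t\ge\zeta$. Put $T_0=0$ and $T_{n}=\inf\{t\ge T_{n-1}:F_*(t)<F_*(T_{n-1})\}$ for $n\ge1$. Let $Z_n=F_*(T_n)^\alpha(\zeta-T_n)$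 for $n\ge 0$, let $\Theta_0=1$, $\mathbf\Delta_0=\mathbf 0$, and for $n\ge1$ let $\Theta_n=F_*(T_n)/F_*(T_{n-1})$ and let $\mathbf\Delta_n=(\Delta_{n,1}\ge\Delta_{n,2}\ge\dots)$ be the sizes, relative to $F_*(T_{n-1})$, of the other sub-blocks produced by the split of the last fragment at time $T_n$. Then $\zeta$ has a density $f_\zeta$ that is continuous and strictly positive on $(0,\infty)$, and the following hold. (a) The process $(Z_n,\Theta_n,\mathbf\Delta_n)_{n\ge0}$ is a time-homogeneous Markov chain. Moreover, conditionally on $\sigma(Z_m,\Theta_m,\mathbf\Delta_m;\,m\le n)$, the law of $(Z_{n+1},\Theta_{n+1},\mathbf\Delta_{n+1})$ depends only on the value of $Z_n$. (b) $(Z_n)_{n\ge0}$ is a time-homogeneous Markov chain with values in $(0,\infty)$ almost surely, and its transition probabilities $P(x,\mathrm dy)$, $x>0$, are given by $$P(x,\mathrm dy)=\frac{e^{-x}}{f_\zeta(x)}\,f_\zeta(y)\left(\int_{\mathcal S_1}\sum_{i:s_i>0}e^{s_i^{-\alpha}y}\prod_{j\ne i}F_\zeta\big(s_j^{\alpha}s_i^{-\alpha}y\big)\mathbf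 1_{\{0<y<s_i^{\alpha}x\}}\,\nu(\mathrm d\mathbf s)\right)\mathrm dy,$$ where a factor with $s_j=0$ is read as $F_\zeta(\infty)=1$. -/

import Mathlib

open MeasureTheory ProbabilityTheory
open scoped ENNReal

noncomputable section

namespace Fragmentation

/-- The set `𝒮₁` of decreasing sequences of nonnegative reals with sum `1`; the index starts at `0`,
so that `s 0` is the largest mass. As a subtype of `ℕ → ℝ` it carries the trace of the product
`σ`-field, which is the Borel `σ`-field of the `ℓ¹`-distance. -/
def massPartitions : Set (ℕ → ℝ) :=
  {s | Antitone s ∧ (∀ i, 0 ≤ s i) ∧ HasSum s 1}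

/-- The marks of the blocks. Blocks are labelled by finite sequences of natural numbers, written
with the most recent generation at the head: `[]` is the initial block and `i :: u` is the `i`-th
sub-block produced by the split of the block `u`. The mark of `u` is the pair of its (unit mean)
exponential clock and of the relative masses of its sub-blocks. -/
abbrev Marks : Type := List ℕ → ℝ × massPartitions

/-- The mass of a block. -/
def mass (ξ : Marks) : List ℕ → ℝ
  | [] => 1
  | i :: u => mass ξ u * ((ξ u).2 : ℕ → ℝ) i

/-- The time of birth of a block: the initial block is born at time `0`, and `i :: u` is born when
`u` splits, that is, `mass u ^ (-α)` times the clock of `u` after the birth of `u`. -/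
def birth (α : ℝ) (ξ : Marks) : List ℕ → ℝ
  | [] => 0
  | _ :: u => birth α ξ u + mass ξ u ^ (-α) * (ξ u).1

/-- The time at which a block splits. -/
def splitTime (α : ℝ) (ξ : Marks) (u : List ℕ) : ℝ :=
  birth α ξ u + mass ξ u ^ (-α) * (ξ u).1

/-- The block `u` is present at time `t`. (For `α < 0`, a label of mass `0` is never present.) -/
def Present (α : ℝ) (ξ : Marks) (u : List ℕ) (t : ℝ) : Prop :=
  birth α ξ u ≤ t ∧ t < splitTime α ξ u

/-- The decreasing rearrangement of a summable family of nonnegative reals (padded by zeros):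
its `n`-th term is the largest `x` such that at least `n + 1` members of the family are `≥ x`. -/
def decreasingRearrangement {ι : Type*} (a : ι → ℝ) (n : ℕ) : ℝ :=
  sSup {x : ℝ | ((n + 1 : ℕ) : ℕ∞) ≤ {i | x ≤ a i}.encard}

open Classical in
/-- The state at time `t` of the fragmentation issued from the block `u`: the decreasing sequence
of the masses of the descendants of `u` (including `u`) that are present at time `t`. -/
def fragmentsOf (α : ℝ) (ξ : Marks) (u : List ℕ) (t : ℝ) : ℕ → ℝ :=
  decreasingRearrangement fun v : List ℕ => if u <:+ v ∧ Present α ξ v t then mass ξ v else 0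

/-- The fragmentation process `F`, started from a single block of mass `1`. -/
def fragmentation (α : ℝ) (ξ : Marks) (t : ℝ) : ℕ → ℝ := fragmentsOf α ξ [] t

/-- The extinction time `ζ` of the fragmentation. (It is almost surely finite.) -/
def extinctionTime (α : ℝ) (ξ : Marks) : ℝ :=
  sInf {t | 0 ≤ t ∧ fragmentation α ξ t = 0}

/-- For a block `u` present at time `t`, the time that it takes, from time `t` on, until all the
mass of `u` is reduced to dust. -/
def residualExtinctionTime (α : ℝ) (ξ : Marks) (u : List ℕ) (t : ℝ) : ℝ :=
  sInf {s | 0 ≤ s ∧ fragmentsOf α ξ u (t + s) = 0}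

/-- Among the blocks present at time `t`, the block `u` takes the longest to become extinct. -/
def IsLastBlock (α : ℝ) (ξ : Marks) (t : ℝ) (u : List ℕ) : Prop :=
  Present α ξ u t ∧
    ∀ v, Present α ξ v t → residualExtinctionTime α ξ v t ≤ residualExtinctionTime α ξ u t

/-- The event that at each time before extinction there is exactly one last block. -/
def HasLastFragment (α : ℝ) (ξ : Marks) : Prop :=
  ∀ t, 0 ≤ t → t < extinctionTime α ξ → ∃! u, IsLastBlock α ξ t u

open Classical in
/-- The label of the last block at time `t` (a junk value if there is none). -/
def lastBlock (α : ℝ) (ξ : Marks) (t : ℝ) : List ℕ :=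
  if h : ∃ u, IsLastBlock α ξ t u then h.choose else []

open Classical in
/-- The last fragment process `F_*`. -/
def lastFragment (α : ℝ) (ξ : Marks) (t : ℝ) : ℝ :=
  if HasLastFragment α ξ ∧ t < extinctionTime α ξ then mass ξ (lastBlock α ξ t) else 0

/-- The jump times of the last fragment process, `T 0 = 0`. -/
def jumpTime (α : ℝ) (ξ : Marks) : ℕ → ℝ
  | 0 => 0
  | n + 1 => sInf {t | jumpTime α ξ n ≤ t ∧
      lastFragment α ξ t < lastFragment α ξ (jumpTime α ξ n)}

/-- `Z n = F_*(T n) ^ α * (ζ - T n)`. -/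
def Z (α : ℝ) (ξ : Marks) (n : ℕ) : ℝ :=
  lastFragment α ξ (jumpTime α ξ n) ^ α * (extinctionTime α ξ - jumpTime α ξ n)

/-- `Θ 0 = 1` and `Θ (n + 1) = F_*(T (n + 1)) / F_*(T n)`. -/
def Θ (α : ℝ) (ξ : Marks) : ℕ → ℝ
  | 0 => 1
  | n + 1 => lastFragment α ξ (jumpTime α ξ (n + 1)) / lastFragment α ξ (jumpTime α ξ n)

/-- The sequence `a` with its `i`-th term removed (it is decreasing if `a` is). -/
def removeTerm (a : ℕ → ℝ) (i j : ℕ) : ℝ := if j < i then a j else a (j + 1)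

/-- `Δ 0 = 0`; `Δ (n + 1)` is the decreasing sequence of the masses, relative to `F_*(T n)`, of the
sub-blocks into which the last block splits at time `T (n + 1)`, without the sub-block that is the
new last block. The sub-blocks of `u` are the `k :: u`, in decreasing order of their masses, and
the rank of the new last block among them is the head of its label. -/
def Δ (α : ℝ) (ξ : Marks) : ℕ → ℕ → ℝ
  | 0 => 0
  | n + 1 => removeTerm
      (fun k => mass ξ (k :: lastBlock α ξ (jumpTime α ξ n)) /
        lastFragment α ξ (jumpTime α ξ n))
      (lastBlock α ξ (jumpTime α ξ (n + 1))).headI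

/-- The triple `(Z n, Θ n, Δ n)`. -/
def chain (α : ℝ) (ξ : Marks) (n : ℕ) : ℝ × ℝ × (ℕ → ℝ) := (Z α ξ n, Θ α ξ n, Δ α ξ n)

/-- `X` is a time-homogeneous Markov chain with transition kernel `κ`: for each `n`, the
conditional law of `X (n + 1)` given `(X 0, …, X n)` is `κ (X n)`. -/
def IsMarkovChain {Ω E : Type*} [MeasurableSpace Ω] [MeasurableSpace E]
    (X : ℕ → Ω → E) (κ : Kernel E E) (P : Measure Ω) : Prop :=
  ∀ n : ℕ, HasCondDistrib (X (n + 1)) (fun ω (m : Finset.Iic n) => X m ω)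
    (κ.comap (fun x : Finset.Iic n → E => x ⟨n, Finset.mem_Iic.2 le_rfl⟩)
      (measurable_pi_apply _)) P

open Classical in
/-- The density at `y` of the transition probability from `x` to `dy`, for a function `f` (the
density of `ζ`) and a function `F` (its cumulative distribution function):
`e⁻ˣ / f x * f y * ∫ ∑_{i : s i > 0} exp (s i ^ (-α) * y) * ∏_{j ≠ i} F (s j ^ α * s i ^ (-α) * y)
* 1_{0 < y < s i ^ α * x} ν(ds)`.
For `s j = 0` the argument of `F` is `∞`, and the factor is `F ∞ = 1`. -/
def transitionDensity (α : ℝ) (ν : Measure massPartitions) (f F : ℝ → ℝ) (x y : ℝ) : ℝ≥0∞ :=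
  ENNReal.ofReal (Real.exp (-x) / f x * f y) *
    ∫⁻ s : massPartitions, ∑' i : ℕ,
      (if 0 < s.1 i ∧ 0 < y ∧ y < s.1 i ^ α * x then
        ENNReal.ofReal (Real.exp (s.1 i ^ (-α) * y) *
          ∏' j : ℕ, if j ≠ i ∧ 0 < s.1 j then F (s.1 j ^ α * s.1 i ^ (-α) * y) else 1)
      else 0) ∂ν

end Fragmentation

end

/-!
Write `ζ = e + R`, where `e` is the clock of the initial block and `R = max_i s_i ^ (-α) ζ_i`, the
`s_i` and `ζ_i` being the masses of its sub-blocks and their extinction times rescaled to mass `1`;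
`e` is exponential and independent of the split, hence of `R`. So `ζ` has the density
`f x = e⁻ˣ E[e ^ R; R < x]`, and given `ζ = x` the split has its original law tilted by
`e ^ R 1_{R < x}`. The density is continuous because `R` has no atoms, and positive because `R` is
arbitrarily small with positive probability. This uses that `R`, a maximum over infinitely many
sub-blocks, is finite and attained, which follows from a moment bound on `ζ`.

If the maximum is attained at `i` only, then `R = s_i ^ (-α) ζ_i` is a function of
`(Z 1, Θ 1, Δ 1)`. The tilt therefore does not affect the conditional law, given this triple, of
the split of the `i`-th sub-block, which by independence is its conditional law given
`ζ_i = Z 1`. Thus each step reproduces the initial situation, with `Z n` in the role of `x`: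
this is the Markov property. Summing over `i` the probability that the other sub-blocks become
extinct before the `i`-th one gives the transition probabilities.
-/

noncomputable section

namespace Fragmentation

section ProductMeasure

variable {ι : Type*} {X : ι → Type*} [∀ i, MeasurableSpace (X i)] (μ : ∀ i, Measure (X i))
  [∀ i, IsProbabilityMeasure (μ i)]

lemma toReal_tprod_of_le_one {f : ι → ℝ≥0∞} (hf : ∀ i, f i ≤ 1) :
    (∏' i, f i).toReal = ∏' i, (f i).toReal := by
  have hprod : HasProd f (∏' i, f i) :=
    (ENNReal.tprod_eq_iInf_prod hf).symm ▸ ENNReal.hasProd_iInf_prod hf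
  have hne : ∏' i, f i ≠ ∞ := by
    rw [ENNReal.tprod_eq_iInf_prod hf]
    exact ne_top_of_le_ne_top ENNReal.one_ne_top ((iInf_le _ ∅).trans (by simp))
  refine (HasProd.tprod_eq ?_).symm
  simpa only [HasProd, ← ENNReal.toReal_prod, Function.comp_def] using
    (ENNReal.tendsto_toReal hne).comp hprod

lemma measureReal_infinitePi_pi_univ [Countable ι] {t : ∀ i, Set (X i)}
    (ht : ∀ i, MeasurableSet (t i)) :
    (Measure.infinitePi μ).real (Set.univ.pi t) = ∏' i, (μ i).real (t i) := by
  rw [measureReal_def, Measure.infinitePi_pi_univ μ ht,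
    toReal_tprod_of_le_one fun _ => prob_le_one]
  rfl

lemma infinitePi_pi_univ_ne_zero [Countable ι] {t : ∀ i, Set (X i)}
    (ht : ∀ i, MeasurableSet (t i)) (hpos : ∀ i, μ i (t i) ≠ 0)
    (hsum : ∑' i, μ i (t i)ᶜ ≠ ∞) : Measure.infinitePi μ (Set.univ.pi t) ≠ 0 := by
  have hone (i : ι) : 1 + -(μ i).real (t i)ᶜ = (μ i).real (t i) := by
    rw [probReal_compl_eq_one_sub (ht i)]; ring
  have hne : ∏' i, (1 + -(μ i).real (t i)ᶜ) ≠ 0 := by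
    refine tprod_one_add_ne_zero_of_summable (fun i => ?_) ?_
    · rw [hone, measureReal_def, ENNReal.toReal_ne_zero]
      exact ⟨hpos i, measure_ne_top _ _⟩
    · simpa [measureReal_def, abs_of_nonneg] using ENNReal.summable_toReal hsum
  simp_rw [hone] at hne
  rw [← measureReal_infinitePi_pi_univ μ ht, measureReal_def] at hne
  exact (ENNReal.toReal_ne_zero.1 hne).1

lemma measurePreserving_update_infinitePi [DecidableEq ι] (i : ι) :
    MeasurePreserving (fun p : (∀ j, X j) × X i => Function.update p.1 i p.2)
      ((Measure.infinitePi μ).prod (μ i)) (Measure.infinitePi μ) := by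
  have hmeas : Measurable fun p : (∀ j, X j) × X i => Function.update p.1 i p.2 :=
    measurable_update'
  refine ⟨hmeas, Measure.eq_infinitePi _ fun s t ht => ?_⟩
  have hpre : (fun p : (∀ j, X j) × X i => Function.update p.1 i p.2) ⁻¹' (s : Set ι).pi t =
      ((s.erase i : Finset ι) : Set ι).pi t ×ˢ if i ∈ s then t i else Set.univ := by
    ext p
    simp only [Set.mem_preimage, Set.mem_pi, Finset.mem_coe, Set.mem_prod, Finset.mem_erase]
    split_ifs with hi <;> grind
  rw [Measure.map_apply hmeas (.pi s.countable_toSet fun j _ => ht j), hpre, Measure.prod_prod,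
    Measure.infinitePi_pi _ fun j _ => ht j]
  split_ifs with hi
  · exact Finset.prod_erase_mul s _ hi
  · rw [measure_univ, mul_one, Finset.erase_eq_of_notMem hi]

end ProductMeasure

section Tree

variable {ι E : Type*}

/-- The labels carried by the descendants of the node `u` of the tree of finite sequences, where
`i :: u` is the `i`-th child of `u`. -/
def subtree (u : List ι) (ξ : List ι → E) : List ι → E := fun v => ξ (v ++ u)

@[simp] lemma subtree_nil (ξ : List ι → E) : subtree [] ξ = ξ := by ext1 v; simp [subtree]

lemma subtree_subtree (u v : List ι) (ξ : List ι → E) :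
    subtree v (subtree u ξ) = subtree (v ++ u) ξ := by ext1 w; simp [subtree]

lemma subtree_cons (i : ι) (u : List ι) (ξ : List ι → E) :
    subtree (i :: u) ξ = subtree [i] (subtree u ξ) := by rw [subtree_subtree]; rfl

variable [MeasurableSpace E]

@[fun_prop]
lemma measurable_subtree (u : List ι) : Measurable (subtree u : (List ι → E) → List ι → E) := by
  unfold subtree; fun_prop

variable (ι) in
/-- The law of a family of independent labels of law `μ` on the tree of finite sequences. -/
abbrev treeLaw (μ : Measure E) : Measure (List ι → E) :=
  Measure.infinitePi fun _ => μ

variable (μ : Measure E) [IsProbabilityMeasure μ]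

lemma measurePreserving_subtree (u : List ι) :
    MeasurePreserving (subtree u) (treeLaw ι μ) (treeLaw ι μ) :=
  ⟨measurable_subtree u, Measure.map_infinitePi_infinitePi_of_inj (List.append_left_injective u)⟩

lemma measurePreserving_children :
    MeasurePreserving (fun (ξ : List ι → E) i => subtree [i] ξ) (treeLaw ι μ)
      (Measure.infinitePi fun _ => treeLaw ι μ) := by
  have hinj : Function.Injective fun p : ι × List ι => p.2 ++ [p.1] := fun p q hpq => by
    obtain ⟨hsnd, hfst⟩ := List.append_inj' hpq rfl
    exact Prod.ext (List.singleton_injective hfst) hsnd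
  refine ⟨by fun_prop, ?_⟩
  rw [← Measure.infinitePi_map_curry fun (_ : ι) (_ : List ι) => μ,
    ← Measure.map_infinitePi_infinitePi_of_inj (P := fun _ : List ι => μ) hinj,
    Measure.map_map (MeasurableEquiv.measurable _) (by fun_prop)]
  rfl

lemma measurePreserving_root_children :
    MeasurePreserving (fun ξ : List ι → E => (ξ [], fun i => subtree [i] ξ)) (treeLaw ι μ)
      (μ.prod (Measure.infinitePi fun _ => treeLaw ι μ)) := by
  classical
  have hmeas : Measurable fun ξ : List ι → E => (ξ [], fun i => subtree [i] ξ) := by fun_prop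
  have hupdate : MeasurePreserving _ ((treeLaw ι μ).prod μ) (treeLaw ι μ) :=
    measurePreserving_update_infinitePi _ []
  have hroot : (fun ξ : List ι → E => (ξ [], fun i => subtree [i] ξ)) ∘
      (fun p => Function.update p.1 [] p.2) =
        Prod.swap ∘ Prod.map (fun (ξ : List ι → E) i => subtree [i] ξ) id := by
    ext p : 2
    · simp
    · ext i v; simp [subtree]
  have hswap := Measure.measurePreserving_swap.comp
    ((measurePreserving_children (ι := ι) μ).prod (.id μ))
  refine ⟨hmeas, ?_⟩
  rw [← hswap.map_eq, ← hroot, ← Measure.map_map hmeas hupdate.measurable, hupdate.map_eq]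

end Tree

section Exponential

lemma lintegral_expMeasure {φ : ℝ → ℝ≥0∞} (hφ : Measurable φ) :
    ∫⁻ e, φ e ∂expMeasure 1 = ∫⁻ e in Set.Ioi 0, ENNReal.ofReal (Real.exp (-e)) * φ e := by
  have hpdf : Measurable (exponentialPDF 1) := (measurable_exponentialPDFReal 1).ennreal_ofReal
  change ∫⁻ e, φ e ∂(volume.withDensity (exponentialPDF 1)) = _
  rw [lintegral_withDensity_eq_lintegral_mul _ hpdf hφ, ← lintegral_indicator measurableSet_Ioi]
  refine lintegral_congr_ae ?_
  filter_upwards [compl_mem_ae_iff.2 (measure_singleton (0 : ℝ))] with e he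
  rcases lt_or_gt_of_ne (show e ≠ 0 from he) with h | h
  · simp [exponentialPDF_of_neg h, h.le]
  · simp [exponentialPDF_of_nonneg h.le, h]

lemma ae_pos_expMeasure : ∀ᵐ e ∂expMeasure 1, 0 < e := by
  have hmeas : Measurable ({e | ¬ 0 < e}.indicator (1 : ℝ → ℝ≥0∞)) :=
    measurable_one.indicator (by measurability)
  rw [ae_iff, ← lintegral_indicator_one (by measurability), lintegral_expMeasure hmeas,
    setLIntegral_eq_zero_iff measurableSet_Ioi (by fun_prop)]
  exact .of_forall fun e he => by simp [Set.indicator, Set.mem_Ioi.1 he]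

lemma lintegral_rpow_expMeasure_lt_top {p : ℝ} (hp : 0 < p) :
    ∫⁻ e, ENNReal.ofReal e ^ p ∂expMeasure 1 < ∞ := by
  rw [lintegral_expMeasure (by fun_prop)]
  have hΓ := (Real.GammaIntegral_convergent (s := p + 1) (by linarith)).lintegral_lt_top
  refine lt_of_eq_of_lt (setLIntegral_congr_fun measurableSet_Ioi fun e he => ?_) hΓ
  simp only [add_sub_cancel_right]
  rw [ENNReal.ofReal_mul (Real.exp_pos _).le, ENNReal.ofReal_rpow_of_nonneg (le_of_lt he) hp.le]

instance isProbabilityMeasure_expMeasure_one : IsProbabilityMeasure (expMeasure 1) :=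
  isProbabilityMeasure_expMeasure one_pos

end Exponential

section Branching

/-- The outcome of the first split, seen from the initial block: the relative masses of its
sub-blocks, and the marks of the fragmentations which these sub-blocks start. -/
abbrev Split : Type := massPartitions × (ℕ → Marks)

/-- The first split of the fragmentation with marks `ξ`. -/
def split (ξ : Marks) : Split := ((ξ []).2, fun i => subtree [i] ξ)

@[fun_prop]
lemma measurable_split : Measurable split := by unfold split; fun_prop

@[fun_prop]
lemma measurable_massPartitions_apply (i : ℕ) : Measurable fun s : massPartitions => s.1 i :=
  (measurable_pi_apply i).comp measurable_subtype_coe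

@[fun_prop]
lemma measurable_split_mass (i : ℕ) : Measurable fun σ : Split => σ.1.1 i :=
  (measurable_massPartitions_apply i).comp measurable_fst

variable (ν : Measure massPartitions) [IsProbabilityMeasure ν]

/-- The law of the marks of a fragmentation with dislocation law `ν`. -/
abbrev marksLaw : Measure Marks := treeLaw ℕ ((expMeasure 1).prod ν)

/-- The law of the first split of a fragmentation with dislocation law `ν`. -/
abbrev splitLaw : Measure Split := ν.prod (Measure.infinitePi fun _ => marksLaw ν)

lemma measurePreserving_clock_split :
    MeasurePreserving (fun ξ : Marks => ((ξ []).1, split ξ)) (marksLaw ν)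
      ((expMeasure 1).prod (splitLaw ν)) :=
  (measurePreserving_prodAssoc _ _ _).comp (measurePreserving_root_children _)

lemma measurePreserving_clock :
    MeasurePreserving (fun ξ : Marks => (ξ []).1) (marksLaw ν) (expMeasure 1) :=
  (measurePreserving_fst (μ := expMeasure 1) (ν := splitLaw ν)).comp
    (measurePreserving_clock_split ν)

lemma measurePreserving_split : MeasurePreserving split (marksLaw ν) (splitLaw ν) :=
  (measurePreserving_snd (μ := expMeasure 1) (ν := splitLaw ν)).comp
    (measurePreserving_clock_split ν)

lemma measurePreserving_split_child (i : ℕ) :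
    MeasurePreserving (fun σ : Split => σ.2 i) (splitLaw ν) (marksLaw ν) :=
  (measurePreserving_eval_infinitePi (fun _ : ℕ => marksLaw ν) i).comp measurePreserving_snd

end Branching

section Masses

variable {ν : Measure massPartitions}

lemma le_one_of_massPartitions (s : massPartitions) (i : ℕ) : s.1 i ≤ 1 :=
  le_hasSum s.2.2.2 i fun j _ => s.2.2.1 j

lemma eq_single_of_head_eq_one {s : massPartitions} (hs : s.1 0 = 1) : s.1 = Pi.single 0 1 := by
  have hzero : HasSum (fun i => s.1 i - Pi.single (M := fun _ => ℝ) 0 1 i) 0 := by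
    simpa using s.2.2.2.sub (hasSum_pi_single (0 : ℕ) (1 : ℝ))
  have hnonneg (i : ℕ) : 0 ≤ s.1 i - Pi.single (M := fun _ => ℝ) 0 1 i := by
    rcases Nat.eq_zero_or_pos i with rfl | hi
    · simp [hs]
    · simpa [Pi.single_apply, hi.ne'] using s.2.2.1 i
  exact funext fun i => sub_eq_zero.1 (congrFun ((hasSum_zero_iff_of_nonneg hnonneg).1 hzero) i)

lemma head_pos (s : massPartitions) : 0 < s.1 0 := by
  refine (s.2.2.1 0).lt_of_ne fun h => ?_
  have hzero : s.1 = fun _ => 0 :=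
    funext fun i => ((s.2.1 i.zero_le).trans_eq h.symm).antisymm (s.2.2.1 i)
  exact zero_ne_one (hasSum_zero.unique (hzero ▸ s.2.2.2))

lemma ae_head_lt_one (hν : ν {s | (s : ℕ → ℝ) = Pi.single 0 1} = 0) :
    ∀ᵐ s ∂ν, s.1 0 < 1 := by
  filter_upwards [measure_eq_zero_iff_ae_notMem.1 hν] with s hs
  exact (le_one_of_massPartitions s 0).lt_of_ne fun h => hs (eq_single_of_head_eq_one h)

lemma tsum_rpow_le_head_rpow {α : ℝ} (hα : α < 0) (s : massPartitions) :
    ∑' i, ENNReal.ofReal (s.1 i ^ (1 - α)) ≤ ENNReal.ofReal (s.1 0 ^ (-α)) := by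
  have hterm (i : ℕ) : ENNReal.ofReal (s.1 i ^ (1 - α)) ≤
      ENNReal.ofReal (s.1 0 ^ (-α)) * ENNReal.ofReal (s.1 i) := by
    rw [← ENNReal.ofReal_mul (Real.rpow_nonneg (s.2.2.1 0) _), show 1 - α = -α + 1 by ring,
      Real.rpow_add' (s.2.2.1 i) (by linarith), Real.rpow_one]
    exact ENNReal.ofReal_le_ofReal <| mul_le_mul_of_nonneg_right
      (Real.rpow_le_rpow (s.2.2.1 i) (s.2.1 i.zero_le) (by linarith)) (s.2.2.1 i)
  calc ∑' i, ENNReal.ofReal (s.1 i ^ (1 - α))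
      ≤ ∑' i, ENNReal.ofReal (s.1 0 ^ (-α)) * ENNReal.ofReal (s.1 i) := ENNReal.tsum_le_tsum hterm
    _ = ENNReal.ofReal (s.1 0 ^ (-α)) := by
      rw [ENNReal.tsum_mul_left, ← ENNReal.ofReal_tsum_of_nonneg s.2.2.1 s.2.2.2.summable,
        s.2.2.2.tsum_eq, ENNReal.ofReal_one, mul_one]

/-- The largest of the values `φ` of the sub-fragmentations started by the first split, weighted
by the factor `s i ^ (-α)` by which the self-similarity rescales time. -/
def weightedSup (α : ℝ) (φ : Marks → ℝ≥0∞) (σ : Split) : ℝ≥0∞ :=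
  ⨆ i, ENNReal.ofReal (σ.1.1 i ^ (-α)) * φ (σ.2 i)

/-- The sum of the values `φ` of the sub-fragmentations started by the first split, weighted by
`s i ^ (1 - α)`. -/
def weightedSum (α : ℝ) (φ : Marks → ℝ≥0∞) (σ : Split) : ℝ≥0∞ :=
  ∑' i, ENNReal.ofReal (σ.1.1 i ^ (1 - α)) * φ (σ.2 i)

@[fun_prop]
lemma measurable_weightedSup (α : ℝ) {φ : Marks → ℝ≥0∞} (hφ : Measurable φ) :
    Measurable (weightedSup α φ) := by unfold weightedSup; fun_prop

@[fun_prop]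
lemma measurable_weightedSum (α : ℝ) {φ : Marks → ℝ≥0∞} (hφ : Measurable φ) :
    Measurable (weightedSum α φ) := by unfold weightedSum; fun_prop

variable (ν) in
/-- The mean of `∑ i, s i ^ (1 - α)` for the dislocation law `ν`. -/
def powerSum (α : ℝ) : ℝ≥0∞ := ∫⁻ s, ∑' i, ENNReal.ofReal (s.1 i ^ (1 - α)) ∂ν

variable [IsProbabilityMeasure ν] {α : ℝ}

lemma powerSum_lt_one (hα : α < 0) (hν : ν {s | (s : ℕ → ℝ) = Pi.single 0 1} = 0) :
    powerSum ν α < 1 := by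
  have hone (s : massPartitions) : ENNReal.ofReal (s.1 0 ^ (-α)) ≤ 1 :=
    ENNReal.ofReal_le_one.2
      (Real.rpow_le_one (s.2.2.1 0) (le_one_of_massPartitions s 0) (by linarith))
  calc powerSum ν α
      ≤ ∫⁻ s, ENNReal.ofReal (s.1 0 ^ (-α)) ∂ν :=
        lintegral_mono fun s => tsum_rpow_le_head_rpow hα s
    _ < ∫⁻ _, 1 ∂ν := by
        refine lintegral_strict_mono (IsProbabilityMeasure.ne_zero ν) (by fun_prop)
          (ne_top_of_le_ne_top (b := ∫⁻ _, 1 ∂ν) (by simp) (lintegral_mono hone)) ?_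
        filter_upwards [ae_head_lt_one hν] with s hs
        exact ENNReal.ofReal_lt_one.2 (Real.rpow_lt_one (s.2.2.1 0) hs (by linarith))
    _ = 1 := by simp

lemma lintegral_weightedSum {φ : Marks → ℝ≥0∞} (hφ : Measurable φ) :
    ∫⁻ σ, weightedSum α φ σ ∂splitLaw ν = powerSum ν α * ∫⁻ ξ, φ ξ ∂marksLaw ν := by
  simp only [weightedSum]
  have hmass (i : ℕ) : Measurable fun s : massPartitions => ENNReal.ofReal (s.1 i ^ (1 - α)) := by
    fun_prop
  rw [lintegral_tsum fun i => by fun_prop, powerSum,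
    lintegral_tsum fun i => (hmass i).aemeasurable, ← ENNReal.tsum_mul_right]
  refine tsum_congr fun i => ?_
  rw [lintegral_prod_mul (f := fun s : massPartitions => ENNReal.ofReal (s.1 i ^ (1 - α)))
    (g := fun η : ℕ → Marks => φ (η i)) (hmass i).aemeasurable
      (hφ.comp (measurable_pi_apply i)).aemeasurable,
    (measurePreserving_eval_infinitePi (fun _ : ℕ => marksLaw ν) i).lintegral_comp hφ]

end Masses

section Lifetime

variable (α : ℝ)

/-- The time until extinction when the blocks of generation `n` are discarded. -/
def truncatedLifetime : ℕ → Marks → ℝ≥0∞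
  | 0, _ => 0
  | n + 1, ξ => ENNReal.ofReal (ξ []).1 + weightedSup α (truncatedLifetime n) (split ξ)

/-- The time until extinction, as an extended real. -/
def lifetime (ξ : Marks) : ℝ≥0∞ := ⨆ n, truncatedLifetime α n ξ

/-- The time between the split of the initial block and extinction, as an extended real. -/
def residualLifetime (σ : Split) : ℝ≥0∞ := weightedSup α (lifetime α) σ

@[fun_prop]
lemma measurable_truncatedLifetime (n : ℕ) : Measurable (truncatedLifetime α n) := by
  induction n with
  | zero => exact measurable_const
  | succ n ih =>
    change Measurable fun ξ : Marks =>
      ENNReal.ofReal (ξ []).1 + weightedSup α (truncatedLifetime α n) (split ξ)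
    fun_prop

@[fun_prop]
lemma measurable_lifetime : Measurable (lifetime α) := by unfold lifetime; fun_prop

@[fun_prop]
lemma measurable_residualLifetime : Measurable (residualLifetime α) := by
  unfold residualLifetime; fun_prop

lemma monotone_truncatedLifetime : Monotone (truncatedLifetime α) := by
  refine monotone_nat_of_le_succ fun n => ?_
  induction n with
  | zero => exact fun _ => zero_le
  | succ n ih =>
    intro ξ
    simp only [truncatedLifetime, weightedSup]
    gcongr with i
    exact ih _

lemma lifetime_eq (ξ : Marks) :
    lifetime α ξ = ENNReal.ofReal (ξ []).1 + residualLifetime α (split ξ) := by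
  calc lifetime α ξ
      = ⨆ n, truncatedLifetime α (n + 1) ξ :=
        (Monotone.iSup_nat_add (f := fun n => truncatedLifetime α n ξ)
          (fun _ _ hmn => monotone_truncatedLifetime α hmn ξ) 1).symm
    _ = ENNReal.ofReal (ξ []).1 + residualLifetime α (split ξ) := by
      simp only [truncatedLifetime, residualLifetime, weightedSup, lifetime, ENNReal.mul_iSup]
      rw [← ENNReal.add_iSup, iSup_comm]

end Lifetime

section Moments

variable {α : ℝ} {ν : Measure massPartitions} [IsProbabilityMeasure ν]

lemma one_lt_one_sub_inv (hα : α < 0) : 1 < 1 - α⁻¹ := by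
  have := inv_lt_zero.2 hα
  linarith

lemma ofReal_rpow_neg_rpow (hα : α < 0) {x : ℝ} (hx : 0 ≤ x) :
    ENNReal.ofReal (x ^ (-α)) ^ (1 - α⁻¹) = ENNReal.ofReal (x ^ (1 - α)) := by
  rw [ENNReal.ofReal_rpow_of_nonneg (by positivity)
    (zero_lt_one.trans (one_lt_one_sub_inv hα)).le, ← Real.rpow_mul hx]
  congr 2
  linarith [mul_inv_cancel₀ hα.ne]

lemma iSup_rpow_le_tsum {ι : Type*} (f : ι → ℝ≥0∞) {p : ℝ} (hp : 0 < p) :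
    (⨆ i, f i) ^ p ≤ ∑' i, f i ^ p :=
  calc (⨆ i, f i) ^ p = ⨆ i, f i ^ p := (ENNReal.orderIsoRpow p hp).map_iSup f
    _ ≤ ∑' i, f i ^ p := iSup_le fun i => ENNReal.le_tsum i

lemma le_mul_inv_one_sub_of_le_add_mul {x : ℕ → ℝ≥0∞} {C r : ℝ≥0∞} (hzero : x 0 = 0)
    (hsucc : ∀ n, x (n + 1) ≤ C + r * x n) (n : ℕ) : x n ≤ C * (1 - r)⁻¹ := by
  have hgeom : (1 - r)⁻¹ = 1 + r * (1 - r)⁻¹ := by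
    conv_lhs => rw [← ENNReal.tsum_geometric, tsum_eq_zero_add' ENNReal.summable]
    simp_rw [pow_zero, pow_succ', ENNReal.tsum_mul_left, ENNReal.tsum_geometric]
  induction n with
  | zero => simp [hzero]
  | succ n ih =>
    calc x (n + 1) ≤ C + r * (C * (1 - r)⁻¹) := (hsucc n).trans (by gcongr)
      _ = C * (1 + r * (1 - r)⁻¹) := by ring
      _ = C * (1 - r)⁻¹ := by rw [← hgeom]

-- The exponent `1 - α⁻¹` turns the weights `s i ^ (-α)` into `s i ^ (1 - α)`, whose sum has a mean
-- smaller than `1`.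
lemma weightedSup_rpow_le (hα : α < 0) (φ : Marks → ℝ≥0∞) (σ : Split) :
    weightedSup α φ σ ^ (1 - α⁻¹) ≤ weightedSum α (fun ξ => φ ξ ^ (1 - α⁻¹)) σ := by
  have hp : 0 < 1 - α⁻¹ := zero_lt_one.trans (one_lt_one_sub_inv hα)
  refine (iSup_rpow_le_tsum _ hp).trans_eq (tsum_congr fun i => ?_)
  rw [ENNReal.mul_rpow_of_nonneg _ _ hp.le, ofReal_rpow_neg_rpow hα (σ.1.2.2.1 i)]

lemma lintegral_truncatedLifetime_succ_rpow_le (hα : α < 0) (n : ℕ) :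
    (∫⁻ ξ, truncatedLifetime α (n + 1) ξ ^ (1 - α⁻¹) ∂marksLaw ν) ^ (1 / (1 - α⁻¹)) ≤
      (∫⁻ e, ENNReal.ofReal e ^ (1 - α⁻¹) ∂expMeasure 1) ^ (1 / (1 - α⁻¹)) +
        powerSum ν α ^ (1 / (1 - α⁻¹)) *
          (∫⁻ ξ, truncatedLifetime α n ξ ^ (1 - α⁻¹) ∂marksLaw ν) ^ (1 / (1 - α⁻¹)) := by
  have hp : 1 < 1 - α⁻¹ := one_lt_one_sub_inv hα
  have hp' : 0 ≤ 1 / (1 - α⁻¹) := by positivity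
  have hminkowski := ENNReal.lintegral_Lp_add_le (μ := marksLaw ν)
    (f := fun ξ => ENNReal.ofReal (ξ []).1)
    (g := fun ξ => weightedSup α (truncatedLifetime α n) (split ξ))
    (by fun_prop : Measurable fun ξ : Marks => ENNReal.ofReal (ξ []).1).aemeasurable
    (by fun_prop : Measurable fun ξ => weightedSup α (truncatedLifetime α n) (split ξ)).aemeasurable
    hp.le
  refine hminkowski.trans (add_le_add (le_of_eq ?_) ?_)
  · rw [(measurePreserving_clock ν).lintegral_comp
      (f := fun e => ENNReal.ofReal e ^ (1 - α⁻¹)) (by fun_prop)]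
  · rw [← ENNReal.mul_rpow_of_nonneg _ _ hp', ← lintegral_weightedSum (by fun_prop),
      (measurePreserving_split ν).lintegral_comp
        (f := fun σ => weightedSup α (truncatedLifetime α n) σ ^ (1 - α⁻¹)) (by fun_prop)]
    exact ENNReal.rpow_le_rpow (lintegral_mono (weightedSup_rpow_le hα _)) hp'

lemma lintegral_lifetime_rpow_lt_top (hα : α < 0)
    (hν : ν {s | (s : ℕ → ℝ) = Pi.single 0 1} = 0) :
    ∫⁻ ξ, lifetime α ξ ^ (1 - α⁻¹) ∂marksLaw ν < ∞ := by
  have hp : 0 < 1 - α⁻¹ := zero_lt_one.trans (one_lt_one_sub_inv hα)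
  have hbound := le_mul_inv_one_sub_of_le_add_mul
    (x := fun n => (∫⁻ ξ, truncatedLifetime α n ξ ^ (1 - α⁻¹) ∂marksLaw ν) ^ (1 / (1 - α⁻¹)))
    (by simp [truncatedLifetime, hp]) (lintegral_truncatedLifetime_succ_rpow_le hα)
  set B := (∫⁻ e, ENNReal.ofReal e ^ (1 - α⁻¹) ∂expMeasure 1) ^ (1 / (1 - α⁻¹)) *
    (1 - powerSum ν α ^ (1 / (1 - α⁻¹)))⁻¹
  have hB : B < ∞ := ENNReal.mul_lt_top
    (ENNReal.rpow_lt_top_of_nonneg (by positivity) (lintegral_rpow_expMeasure_lt_top hp).ne)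
    (ENNReal.inv_lt_top.2 <| tsub_pos_of_lt <|
      ENNReal.rpow_lt_one (powerSum_lt_one hα hν) (by positivity))
  have hiSup (ξ : Marks) :
      lifetime α ξ ^ (1 - α⁻¹) = ⨆ n, truncatedLifetime α n ξ ^ (1 - α⁻¹) :=
    (ENNReal.orderIsoRpow _ hp).map_iSup _
  simp_rw [hiSup]
  rw [lintegral_iSup (fun n => by fun_prop) fun m n hmn ξ =>
    ENNReal.rpow_le_rpow (monotone_truncatedLifetime α hmn ξ) hp.le]
  refine (iSup_le fun n => ?_).trans_lt (ENNReal.rpow_lt_top_of_nonneg hp.le hB.ne)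
  rw [← ENNReal.rpow_inv_le_iff hp, ← one_div (1 - α⁻¹)]
  exact hbound n

variable (α) in
/-- The sum over the blocks of generation `n` of the `(1 - α⁻¹)`-th power of the time elapsed
between the birth of the block and the extinction of its descendants. -/
def generationSum : ℕ → Marks → ℝ≥0∞
  | 0, ξ => lifetime α ξ ^ (1 - α⁻¹)
  | n + 1, ξ => weightedSum α (generationSum n) (split ξ)

@[fun_prop]
lemma measurable_generationSum (n : ℕ) : Measurable (generationSum α n) := by
  induction n with
  | zero => exact (measurable_lifetime α).pow_const _
  | succ n ih =>
    change Measurable fun ξ => weightedSum α (generationSum α n) (split ξ)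
    fun_prop

lemma lintegral_generationSum (n : ℕ) : ∫⁻ ξ, generationSum α n ξ ∂marksLaw ν =
    powerSum ν α ^ n * ∫⁻ ξ, lifetime α ξ ^ (1 - α⁻¹) ∂marksLaw ν := by
  induction n with
  | zero => simp [generationSum]
  | succ n ih =>
    simp only [generationSum]
    rw [(measurePreserving_split ν).lintegral_comp (f := weightedSum α (generationSum α n))
      (by fun_prop), lintegral_weightedSum (by fun_prop), ih, pow_succ]
    ring

lemma ae_tsum_generationSum_lt_top (hα : α < 0)
    (hν : ν {s | (s : ℕ → ℝ) = Pi.single 0 1} = 0) :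
    ∀ᵐ ξ ∂marksLaw ν, ∑' n, generationSum α n ξ < ∞ := by
  refine ae_lt_top (by fun_prop) ?_
  rw [lintegral_tsum fun n => by fun_prop]
  simp_rw [lintegral_generationSum, ENNReal.tsum_mul_right, ENNReal.tsum_geometric]
  exact (ENNReal.mul_lt_top (ENNReal.inv_lt_top.2 (tsub_pos_of_lt (powerSum_lt_one hα hν)))
    (lintegral_lifetime_rpow_lt_top hα hν)).ne

lemma ae_lifetime_lt_top (hα : α < 0) (hν : ν {s | (s : ℕ → ℝ) = Pi.single 0 1} = 0) :
    ∀ᵐ ξ ∂marksLaw ν, lifetime α ξ < ∞ := by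
  have hp : 0 < 1 - α⁻¹ := zero_lt_one.trans (one_lt_one_sub_inv hα)
  filter_upwards [ae_lt_top (by fun_prop) (lintegral_lifetime_rpow_lt_top hα hν).ne] with ξ hξ
  exact (ENNReal.rpow_lt_top_iff_of_pos hp).1 hξ

end Moments

section ConditionalDistribution

variable {Ω E F : Type*} [MeasurableSpace Ω] [MeasurableSpace E] [MeasurableSpace F]
  {P : Measure Ω} {X : Ω → E} {Y : Ω → F} {κ : Kernel E F}

lemma hasCondDistrib_comp_measurePreserving {Ω' : Type*} [MeasurableSpace Ω'] {Q : Measure Ω'}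
    (h : HasCondDistrib Y X κ P) {T : Ω' → Ω} (hT : MeasurePreserving T Q P) :
    HasCondDistrib (Y ∘ T) (X ∘ T) κ Q := by
  have hcomp := HasLaw.comp h hT.hasLaw
  rwa [← hT.map_eq, AEMeasurable.map_map_of_aemeasurable
    (by rw [hT.map_eq]; exact h.aemeasurable_fst) hT.aemeasurable] at hcomp

lemma hasCondDistrib_congr (h : HasCondDistrib Y X κ P) {X' : Ω → E} {Y' : Ω → F}
    (hX : X' =ᵐ[P] X) (hY : Y' =ᵐ[P] Y) : HasCondDistrib Y' X' κ P := by
  have hlaw := HasLaw.congr h (hX.prodMk hY)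
  rwa [← Measure.map_congr hX] at hlaw

variable [SFinite P] [IsSFiniteKernel κ]

lemma lintegral_map_compProd (hX : AEMeasurable X P) {φ : E × F → ℝ≥0∞} (hφ : Measurable φ) :
    ∫⁻ p, φ p ∂(P.map X ⊗ₘ κ) = ∫⁻ ω, ∫⁻ y, φ (X ω, y) ∂κ (X ω) ∂P := by
  rw [Measure.lintegral_compProd hφ, lintegral_map' _ hX]
  exact hφ.lintegral_kernel_prod_right'.aemeasurable

lemma hasCondDistrib_iff_lintegral (hX : AEMeasurable X P) (hY : AEMeasurable Y P) :
    HasCondDistrib Y X κ P ↔ ∀ φ : E × F → ℝ≥0∞, Measurable φ →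
      ∫⁻ ω, φ (X ω, Y ω) ∂P = ∫⁻ ω, ∫⁻ y, φ (X ω, y) ∂κ (X ω) ∂P := by
  refine ⟨fun h φ hφ => ?_, fun h => ⟨hX.prodMk hY, Measure.ext_of_lintegral _ fun φ hφ => ?_⟩⟩
  · rw [← lintegral_map_compProd hX hφ, ← h.map_eq, lintegral_map' hφ.aemeasurable h.aemeasurable]
  · rw [lintegral_map_compProd hX hφ, lintegral_map' hφ.aemeasurable (hX.prodMk hY), h φ hφ]

lemma hasCondDistrib_withDensity_comp (h : HasCondDistrib Y X κ P) {w : E → ℝ≥0∞}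
    (hw : Measurable w) : HasCondDistrib Y X κ (P.withDensity (w ∘ X)) := by
  have hX := h.aemeasurable_fst
  have hY := h.aemeasurable_snd
  have hac := withDensity_absolutelyContinuous P (w ∘ X)
  have hwX : AEMeasurable (w ∘ X) P := hw.comp_aemeasurable hX
  rw [hasCondDistrib_iff_lintegral (hX.mono_ac hac) (hY.mono_ac hac)]
  intro φ hφ
  have hκφ : AEMeasurable (fun ω => ∫⁻ y, φ (X ω, y) ∂κ (X ω)) P :=
    (Measurable.lintegral_kernel_prod_right' (κ := κ) hφ).comp_aemeasurable hX
  rw [lintegral_withDensity_eq_lintegral_mul₀ hwX (by fun_prop),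
    lintegral_withDensity_eq_lintegral_mul₀ hwX hκφ]
  simp only [Pi.mul_apply, Function.comp_apply]
  rw [(hasCondDistrib_iff_lintegral hX hY).1 h (fun p => w p.1 * φ p) (by fun_prop)]
  exact lintegral_congr fun ω => lintegral_const_mul (w (X ω)) (hφ.comp measurable_prodMk_left)

end ConditionalDistribution

section MarkovChain

variable {F : Type*}

/-- The observations `(Y 0, …, Y n)`, indexed as in `IsMarkovChain`. -/
def history {Ω : Type*} (Y : ℕ → Ω → F) (n : ℕ) (ω : Ω) (m : Finset.Iic n) : F := Y m ω

/-- The sequence `(x 0, …, x n)` followed by `y`. -/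
def snocHistory (n : ℕ) (p : (Finset.Iic n → F) × F) (m : Finset.Iic (n + 1)) : F :=
  if h : (m : ℕ) ≤ n then p.1 ⟨m, Finset.mem_Iic.2 h⟩ else p.2

lemma snocHistory_history {Ω : Type*} (Y : ℕ → Ω → F) (n : ℕ) (ω : Ω) :
    snocHistory n (history Y n ω, Y (n + 1) ω) = history Y (n + 1) ω := by
  funext m
  have hm := Finset.mem_Iic.1 m.2
  unfold snocHistory history
  split_ifs with h
  · rfl
  · rw [show (m : ℕ) = n + 1 by omega]

lemma snocHistory_last (n : ℕ) (p : (Finset.Iic n → F) × F) :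
    snocHistory n p ⟨n + 1, Finset.mem_Iic.2 le_rfl⟩ = p.2 := by
  simp [snocHistory]

variable {Ω E : Type*} [MeasurableSpace Ω] [MeasurableSpace E] [MeasurableSpace F]

@[fun_prop]
lemma measurable_snocHistory (n : ℕ) : Measurable (snocHistory (F := F) n) := by
  refine measurable_pi_lambda _ fun m => ?_
  unfold snocHistory
  split_ifs <;> fun_prop

/-- The kernel which sends `(x 0, …, x n)` to `κ (x n)`. -/
def lastKernel (κ : Kernel F E) (n : ℕ) : Kernel (Finset.Iic n → F) E :=
  κ.comap (fun x => x ⟨n, Finset.mem_Iic.2 le_rfl⟩) (measurable_pi_apply _)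

instance (κ : Kernel F E) [IsMarkovKernel κ] (n : ℕ) : IsMarkovKernel (lastKernel κ n) := by
  unfold lastKernel
  infer_instance

lemma lastKernel_map (κ : Kernel F E) (n : ℕ) {E' : Type*} [MeasurableSpace E'] {f : E → E'}
    (hf : Measurable f) : (lastKernel κ n).map f = lastKernel (κ.map f) n := by
  ext1 x
  rw [lastKernel, lastKernel, Kernel.map_apply _ hf, Kernel.comap_apply, Kernel.comap_apply,
    Kernel.map_apply _ hf]

variable {P : Measure Ω} [IsProbabilityMeasure P] {κ : Kernel F E} [IsMarkovKernel κ]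
  {S : ℕ → Ω → E} {Y : ℕ → Ω → F} {g : E → E} {f : E → F}

lemma hasCondDistrib_history_zero {X : Ω → E} (h : HasCondDistrib X (Y 0) κ P) :
    HasCondDistrib X (history Y 0) (lastKernel κ 0) P := by
  have hconst : Measurable fun (y : F) (_ : Finset.Iic 0) => y := by fun_prop
  have hY : history Y 0 = (fun y _ => y) ∘ Y 0 := by
    funext ω m
    have := Finset.mem_Iic.1 m.2
    simp [history, show (m : ℕ) = 0 by omega]
  rw [hY]
  exact HasCondDistrib.comp_right (hf := hconst) h

lemma hasCondDistrib_history_succ {X : Ω → E} {n : ℕ}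
    (h : HasCondDistrib X (fun ω => (history Y n ω, Y (n + 1) ω))
      (κ.comap Prod.snd measurable_snd : Kernel ((Finset.Iic n → F) × F) E) P) :
    HasCondDistrib X (history Y (n + 1)) (lastKernel κ (n + 1)) P := by
  rw [← funext (snocHistory_history Y n)]
  refine HasCondDistrib.comp_right (hf := measurable_snocHistory n)
    (Z := fun ω => (history Y n ω, Y (n + 1) ω)) ?_
  convert h using 1
  ext1 p
  simp only [lastKernel, Kernel.comap_apply, snocHistory_last]

/-- The state `S n` is not a function of the observation `Y n`. But if its conditional law given
`Y n` is `κ`, and if one step of the dynamics preserves this relation, then its conditional law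
given the whole history `Y 0, …, Y n` is `κ` as well. -/
lemma hasCondDistrib_state_history (hf : Measurable f) (hg : Measurable g)
    (hS : ∀ n ω, S (n + 1) ω = g (S n ω)) (hY : ∀ n ω, Y (n + 1) ω = f (S n ω))
    (h0 : HasCondDistrib (S 0) (Y 0) κ P) (hκ : ∀ y, HasCondDistrib g f κ (κ y)) (n : ℕ) :
    HasCondDistrib (S n) (history Y n) (lastKernel κ n) P := by
  induction n with
  | zero => exact hasCondDistrib_history_zero h0
  | succ n ih =>
    have hkernel : lastKernel (κ.map fun s => (f s, g s)) n =
        lastKernel (κ.map f) n ⊗ₖ κ.comap Prod.snd measurable_snd := by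
      ext1 x
      rw [lastKernel, lastKernel, Kernel.compProd_apply_eq_compProd_sectR, Kernel.comap_apply,
        Kernel.comap_apply, Kernel.map_apply _ (hf.prodMk hg), Kernel.map_apply _ hf,
        (hκ _).map_eq]
      rfl
    have hpair := ih.comp_left (hf.prodMk hg)
    rw [lastKernel_map _ _ (hf.prodMk hg), hkernel] at hpair
    have : IsMarkovKernel (κ.map f) := Kernel.IsMarkovKernel.map _ hf
    refine hasCondDistrib_history_succ ?_
    simp only [funext (hS n), hY]
    exact hpair.of_compProd

lemma isMarkovChain_of_hasCondDistrib_state (hf : Measurable f) (hg : Measurable g)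
    (hS : ∀ n ω, S (n + 1) ω = g (S n ω)) (hY : ∀ n ω, Y (n + 1) ω = f (S n ω))
    (h0 : HasCondDistrib (S 0) (Y 0) κ P) (hκ : ∀ y, HasCondDistrib g f κ (κ y)) :
    IsMarkovChain Y (κ.map f) P := fun n => by
  have hstate := (hasCondDistrib_state_history hf hg hS hY h0 hκ n).comp_left hf
  rw [lastKernel_map _ _ hf] at hstate
  rw [funext (hY n)]
  exact hstate

end MarkovChain

section Tilt

variable {E : Type*} [MeasurableSpace E]

/-- `exp (G y)` on the event `G y < x`. -/
def tiltWeight (G : E → ℝ) (x : ℝ) (y : E) : ℝ≥0∞ :=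
  if G y < x then ENNReal.ofReal (Real.exp (G y)) else 0

/-- The integral of `exp G` on the event `G < x`. -/
def tiltMass (m : Measure E) (G : E → ℝ) (x : ℝ) : ℝ≥0∞ := ∫⁻ y, tiltWeight G x y ∂m

/-- The density on `(0, ∞)` of the sum of a standard exponential variable and of an independent
variable `G ≥ 0`. -/
def tiltDensity (m : Measure E) (G : E → ℝ) (x : ℝ) : ℝ := Real.exp (-x) * (tiltMass m G x).toReal

/-- The conditional law of `y` given that `e + G y = x`, where `e` is a standard exponential
variable and `y` has law `m`. For `x ≤ 0` it is `m`. -/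
def tiltKernel (m : Measure E) [SFinite m] (G : E → ℝ) : Kernel ℝ E :=
  (Kernel.const ℝ m).withDensity
    fun x y => if 0 < x then (tiltMass m G x)⁻¹ * tiltWeight G x y else 1

variable {m : Measure E} {G : E → ℝ}

lemma measurable_tiltWeight (hG : Measurable G) : Measurable (Function.uncurry (tiltWeight G)) :=
  Measurable.ite (measurableSet_lt (hG.comp measurable_snd) measurable_fst)
    (by fun_prop) measurable_const

lemma measurable_tiltMass [SFinite m] (hG : Measurable G) : Measurable (tiltMass m G) :=
  (measurable_tiltWeight hG).lintegral_prod_right'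

lemma measurable_tiltDensity [SFinite m] (hG : Measurable G) : Measurable (tiltDensity m G) :=
  Measurable.mul (by fun_prop) (measurable_tiltMass hG).ennreal_toReal

omit [MeasurableSpace E] in
lemma tiltWeight_le {x b : ℝ} (hx : x ≤ b) (y : E) :
    tiltWeight G x y ≤ ENNReal.ofReal (Real.exp b) := by
  unfold tiltWeight
  split_ifs with h
  · exact ENNReal.ofReal_le_ofReal (Real.exp_le_exp.2 (h.le.trans hx))
  · exact zero_le

lemma lintegral_tiltWeight_mul_const (hG : Measurable G) (x : ℝ) (c : ℝ≥0∞) :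
    ∫⁻ y, tiltWeight G x y * c ∂m = tiltMass m G x * c :=
  lintegral_mul_const _ (measurable_tiltWeight hG).of_uncurry_left

lemma tiltMass_ne_top [IsFiniteMeasure m] (x : ℝ) : tiltMass m G x ≠ ∞ :=
  ne_top_of_le_ne_top (by simp [ENNReal.mul_ne_top])
    (lintegral_mono (μ := m) (tiltWeight_le (le_refl x)))

lemma tiltMass_ne_zero (hG : Measurable G) {x : ℝ} (h : m {y | G y < x} ≠ 0) :
    tiltMass m G x ≠ 0 := fun h0 => by
  rw [tiltMass, lintegral_eq_zero_iff (measurable_tiltWeight hG).of_uncurry_left] at h0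
  refine h (measure_mono_null (fun y hy => ?_) (ae_iff.1 h0))
  simp [tiltWeight, show G y < x from hy, Real.exp_pos]

lemma ofReal_tiltDensity [IsFiniteMeasure m] (x : ℝ) :
    ENNReal.ofReal (tiltDensity m G x) = ENNReal.ofReal (Real.exp (-x)) * tiltMass m G x := by
  rw [tiltDensity, ENNReal.ofReal_mul (Real.exp_pos _).le,
    ENNReal.ofReal_toReal (tiltMass_ne_top x)]

lemma tiltKernel_apply [SFinite m] (hG : Measurable G) (x : ℝ) : tiltKernel m G x =
    m.withDensity fun y => if 0 < x then (tiltMass m G x)⁻¹ * tiltWeight G x y else 1 := by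
  rw [tiltKernel, Kernel.withDensity_apply, Kernel.const_apply]
  exact Measurable.ite (measurableSet_lt measurable_const measurable_fst)
    (((measurable_tiltMass hG).comp measurable_fst).inv.mul (measurable_tiltWeight hG))
    measurable_const

lemma lintegral_tiltKernel [SFinite m] (hG : Measurable G) {x : ℝ} (hx : 0 < x) {φ : E → ℝ≥0∞}
    (hφ : Measurable φ) :
    ∫⁻ y, φ y ∂tiltKernel m G x = (tiltMass m G x)⁻¹ * ∫⁻ y, tiltWeight G x y * φ y ∂m := by
  have hw : Measurable (tiltWeight G x) := (measurable_tiltWeight hG).of_uncurry_left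
  simp only [tiltKernel_apply hG, hx, if_true]
  rw [lintegral_withDensity_eq_lintegral_mul _ (hw.const_mul _) hφ,
    ← lintegral_const_mul _ (by fun_prop)]
  simp only [Pi.mul_apply, mul_assoc]

lemma isMarkovKernel_tiltKernel [IsProbabilityMeasure m] (hG : Measurable G)
    (hpos : ∀ x, 0 < x → tiltMass m G x ≠ 0) : IsMarkovKernel (tiltKernel m G) := by
  refine ⟨fun x => ⟨?_⟩⟩
  rw [← lintegral_one]
  rcases le_or_gt x 0 with hx | hx
  · simp [tiltKernel_apply hG, hx.not_gt]
  · rw [lintegral_tiltKernel hG hx measurable_const, lintegral_tiltWeight_mul_const hG, mul_one]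
    exact ENNReal.inv_mul_cancel (hpos x hx) (tiltMass_ne_top x)

lemma lintegral_exp_add [SFinite m] (hG : Measurable G) (hG0 : ∀ y, 0 ≤ G y) {φ : ℝ × E → ℝ≥0∞}
    (hφ : Measurable φ) :
    ∫⁻ p, φ (p.1 + G p.2, p.2) ∂(expMeasure 1).prod m =
      ∫⁻ x in Set.Ioi 0, ENNReal.ofReal (Real.exp (-x)) * ∫⁻ y, tiltWeight G x y * φ (x, y) ∂m := by
  have hshift (y : E) : ∫⁻ e, φ (e + G y, y) ∂expMeasure 1 =
      ∫⁻ x in Set.Ioi 0, ENNReal.ofReal (Real.exp (-x)) * (tiltWeight G x y * φ (x, y)) := by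
    rw [lintegral_expMeasure (φ := fun e => φ (e + G y, y)) (by fun_prop),
      ← lintegral_indicator measurableSet_Ioi, ← lintegral_indicator measurableSet_Ioi,
      ← lintegral_sub_right_eq_self _ (G y)]
    refine lintegral_congr fun x => ?_
    simp only [Set.indicator, Set.mem_Ioi, tiltWeight, sub_pos]
    by_cases h : G y < x
    · simp only [h, if_true, (hG0 y).trans_lt h, sub_add_cancel]
      rw [← mul_assoc, ← ENNReal.ofReal_mul (Real.exp_pos _).le, ← Real.exp_add]
      congr 3
      ring
    · simp [h]
  have hw : Measurable fun p : E × ℝ => tiltWeight G p.2 p.1 :=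
    (measurable_tiltWeight hG).comp measurable_swap
  rw [lintegral_prod_symm' _ (by fun_prop)]
  simp_rw [hshift]
  rw [lintegral_lintegral_swap]
  · refine lintegral_congr fun x => lintegral_const_mul _ ?_
    exact (measurable_tiltWeight hG).of_uncurry_left.mul (hφ.comp measurable_prodMk_left)
  · exact ((by fun_prop : Measurable fun p : E × ℝ => ENNReal.ofReal (Real.exp (-p.2))).mul
      (hw.mul (hφ.comp measurable_swap))).aemeasurable

lemma hasLaw_exp_add [IsFiniteMeasure m] (hG : Measurable G) (hG0 : ∀ y, 0 ≤ G y) :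
    HasLaw (fun p : ℝ × E => p.1 + G p.2)
      ((volume.restrict (Set.Ioi 0)).withDensity fun x => ENNReal.ofReal (tiltDensity m G x))
      ((expMeasure 1).prod m) := by
  have hsum : Measurable fun p : ℝ × E => p.1 + G p.2 := by fun_prop
  have hdensity : Measurable fun x => ENNReal.ofReal (tiltDensity m G x) :=
    (measurable_tiltDensity hG).ennreal_ofReal
  refine ⟨hsum.aemeasurable, Measure.ext_of_lintegral _ fun φ hφ => ?_⟩
  rw [lintegral_map hφ hsum, lintegral_withDensity_eq_lintegral_mul _ hdensity hφ,
    lintegral_exp_add hG hG0 (φ := fun q => φ q.1) (by fun_prop)]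
  refine lintegral_congr fun x => ?_
  dsimp only
  rw [lintegral_tiltWeight_mul_const hG, Pi.mul_apply, ofReal_tiltDensity, mul_assoc]

lemma hasCondDistrib_exp_add [IsProbabilityMeasure m] (hG : Measurable G) (hG0 : ∀ y, 0 ≤ G y)
    (hpos : ∀ x, 0 < x → tiltMass m G x ≠ 0) :
    HasCondDistrib Prod.snd (fun p : ℝ × E => p.1 + G p.2) (tiltKernel m G)
      ((expMeasure 1).prod m) := by
  have hκ := isMarkovKernel_tiltKernel hG hpos
  rw [hasCondDistrib_iff_lintegral (by fun_prop) (by fun_prop)]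
  intro φ hφ
  rw [lintegral_exp_add hG hG0 hφ, lintegral_exp_add hG hG0
    (φ := fun q => ∫⁻ y, φ (q.1, y) ∂tiltKernel m G q.1)
    (Measurable.lintegral_kernel_prod_right' (κ := tiltKernel m G) hφ |>.comp measurable_fst)]
  refine setLIntegral_congr_fun measurableSet_Ioi fun x hx => ?_
  dsimp only
  rw [lintegral_tiltWeight_mul_const hG, lintegral_tiltKernel hG hx (by fun_prop),
    ← mul_assoc (tiltMass m G x), ENNReal.mul_inv_cancel (hpos x hx) (tiltMass_ne_top x), one_mul]

lemma continuousOn_tiltDensity [IsFiniteMeasure m] (hG : Measurable G)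
    (hatom : ∀ x, 0 < x → m {y | G y = x} = 0) : ContinuousOn (tiltDensity m G) (Set.Ioi 0) := by
  intro x hx
  refine ContinuousAt.continuousWithinAt (ContinuousAt.mul (by fun_prop) ?_)
  refine (ENNReal.tendsto_toReal (tiltMass_ne_top x)).comp ?_
  refine tendsto_lintegral_filter_of_dominated_convergence
    (fun _ => ENNReal.ofReal (Real.exp (x + 1))) ?_ ?_ (by simp [ENNReal.mul_ne_top]) ?_
  · exact Filter.Eventually.of_forall fun x => (measurable_tiltWeight hG).of_uncurry_left
  · filter_upwards [gt_mem_nhds (lt_add_one x)] with z hz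
    exact Filter.Eventually.of_forall (tiltWeight_le hz.le)
  · have hne : ∀ᵐ y ∂m, G y ≠ x := by simpa [ae_iff] using hatom x hx
    filter_upwards [hne] with y hy
    refine tendsto_const_nhds.congr' ?_
    rcases lt_or_gt_of_ne hy with h | h
    · filter_upwards [lt_mem_nhds h] with z hz
      simp [tiltWeight, h, hz]
    · filter_upwards [gt_mem_nhds h] with z hz
      simp [tiltWeight, h.not_gt, hz.not_gt]

end Tilt

section Resampling

/-- The split obtained by replacing the sub-fragmentation issued from the `i`-th child. -/
def resampleChild (i : ℕ) (p : Split × Marks) : Split := (p.1.1, Function.update p.1.2 i p.2)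

@[simp]
lemma resampleChild_fst (i : ℕ) (p : Split × Marks) : (resampleChild i p).1 = p.1.1 := rfl

@[simp]
lemma resampleChild_snd_self (i : ℕ) (p : Split × Marks) : (resampleChild i p).2 i = p.2 := by
  simp [resampleChild]

lemma resampleChild_snd_of_ne {i j : ℕ} (h : j ≠ i) (p : Split × Marks) :
    (resampleChild i p).2 j = p.1.2 j := by
  simp [resampleChild, h]

variable (ν : Measure massPartitions) [IsProbabilityMeasure ν]

lemma measurePreserving_resampleChild (i : ℕ) :
    MeasurePreserving (resampleChild i) ((splitLaw ν).prod (marksLaw ν)) (splitLaw ν) := by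
  have hupdate := measurePreserving_update_infinitePi (fun _ : ℕ => marksLaw ν) i
  exact ((MeasurePreserving.id ν).prod hupdate).comp (measurePreserving_prodAssoc _ _ _)

lemma lintegral_resampleChild (i : ℕ) {φ : Split × Marks → ℝ≥0∞} (hφ : Measurable φ)
    (hinv : ∀ σ ζ ζ', φ (resampleChild i (σ, ζ'), ζ) = φ (σ, ζ)) :
    ∫⁻ σ, φ (σ, σ.2 i) ∂splitLaw ν = ∫⁻ σ, ∫⁻ ζ, φ (σ, ζ) ∂marksLaw ν ∂splitLaw ν := by
  rw [← lintegral_prod _ hφ.aemeasurable,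
    ← (measurePreserving_resampleChild ν i).lintegral_comp (by fun_prop)]
  simp only [resampleChild_snd_self, hinv]

end Resampling

section ExtinctionTime

variable (α : ℝ)

/-- The time until extinction, as a real number. -/
def lifetimeReal (ξ : Marks) : ℝ := (lifetime α ξ).toReal

/-- The time between the split of the initial block and extinction, as a real number. -/
def residualReal (σ : Split) : ℝ := (residualLifetime α σ).toReal

/-- The time between the split of the initial block and the extinction of the descendants of its
`i`-th sub-block. -/
def branch (σ : Split) (i : ℕ) : ℝ := σ.1.1 i ^ (-α) * lifetimeReal α (σ.2 i)

@[fun_prop]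
lemma measurable_lifetimeReal : Measurable (lifetimeReal α) := by unfold lifetimeReal; fun_prop

@[fun_prop]
lemma measurable_residualReal : Measurable (residualReal α) := by unfold residualReal; fun_prop

@[fun_prop]
lemma measurable_branch (i : ℕ) : Measurable fun σ => branch α σ i := by unfold branch; fun_prop

lemma lifetimeReal_nonneg (ξ : Marks) : 0 ≤ lifetimeReal α ξ := ENNReal.toReal_nonneg

lemma residualReal_nonneg (σ : Split) : 0 ≤ residualReal α σ := ENNReal.toReal_nonneg

lemma branch_eq_toReal (σ : Split) (i : ℕ) :
    branch α σ i = (ENNReal.ofReal (σ.1.1 i ^ (-α)) * lifetime α (σ.2 i)).toReal := by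
  rw [ENNReal.toReal_mul, ENNReal.toReal_ofReal (Real.rpow_nonneg (σ.1.2.2.1 i) _)]
  rfl

variable {α}

lemma residualLifetime_lt_top {ξ : Marks} (h : lifetime α ξ < ∞) :
    residualLifetime α (split ξ) < ∞ :=
  (le_add_self.trans_eq (lifetime_eq α ξ).symm).trans_lt h

lemma lifetimeReal_eq {ξ : Marks} (hclock : 0 < (ξ []).1) (h : lifetime α ξ < ∞) :
    lifetimeReal α ξ = (ξ []).1 + residualReal α (split ξ) := by
  rw [lifetimeReal, lifetime_eq, ENNReal.toReal_add ENNReal.ofReal_ne_top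
    (residualLifetime_lt_top h).ne, ENNReal.toReal_ofReal hclock.le, residualReal]

variable {ν : Measure massPartitions} [IsProbabilityMeasure ν]

lemma lifetimeReal_ae_eq (hα : α < 0) (hν : ν {s | (s : ℕ → ℝ) = Pi.single 0 1} = 0) :
    lifetimeReal α =ᵐ[marksLaw ν] fun ξ => (ξ []).1 + residualReal α (split ξ) := by
  filter_upwards [(measurePreserving_clock ν).quasiMeasurePreserving.ae ae_pos_expMeasure,
    ae_lifetime_lt_top hα hν] with ξ hclock hfin
  exact lifetimeReal_eq hclock hfin

variable (α ν) in
/-- The density of the extinction time. -/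
def extinctionDensity : ℝ → ℝ := tiltDensity (splitLaw ν) (residualReal α)

lemma hasLaw_lifetimeReal (hα : α < 0) (hν : ν {s | (s : ℕ → ℝ) = Pi.single 0 1} = 0) :
    HasLaw (lifetimeReal α) ((volume.restrict (Set.Ioi 0)).withDensity
      fun x => ENNReal.ofReal (extinctionDensity α ν x)) (marksLaw ν) :=
  ((hasLaw_exp_add (measurable_residualReal α) (residualReal_nonneg α)).comp
    (measurePreserving_clock_split ν).hasLaw).congr (lifetimeReal_ae_eq hα hν)

lemma measure_lifetimeReal_eq (hα : α < 0) (hν : ν {s | (s : ℕ → ℝ) = Pi.single 0 1} = 0)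
    (c : ℝ) : marksLaw ν {ξ | lifetimeReal α ξ = c} = 0 := by
  change marksLaw ν (lifetimeReal α ⁻¹' {c}) = 0
  rw [← Measure.map_apply (measurable_lifetimeReal α) (measurableSet_singleton c),
    (hasLaw_lifetimeReal hα hν).map_eq]
  exact ((withDensity_absolutelyContinuous _ _).trans Measure.restrict_le_self.absolutelyContinuous)
    (measure_singleton c)

lemma ae_branch_eq_imp (hα : α < 0) (hν : ν {s | (s : ℕ → ℝ) = Pi.single 0 1} = 0) (i : ℕ)
    {c : Split → ℝ} (hc : Measurable c) (hinv : ∀ σ ζ, c (resampleChild i (σ, ζ)) = c σ) :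
    ∀ᵐ σ ∂splitLaw ν, branch α σ i = c σ → c σ = 0 := by
  have hmeas : MeasurableSet {σ | branch α σ i = c σ → c σ = 0} :=
    (measurableSet_eq_fun (by fun_prop) hc).imp (measurableSet_eq_fun hc measurable_const)
  rw [← (measurePreserving_resampleChild ν i).map_eq,
    ae_map_iff (measurePreserving_resampleChild ν i).aemeasurable hmeas]
  refine (Measure.ae_prod_iff_ae_ae
    (hmeas.preimage (measurePreserving_resampleChild ν i).measurable)).2 (.of_forall fun σ => ?_)
  have hne : ∀ᵐ ζ ∂marksLaw ν, lifetimeReal α ζ ≠ c σ / σ.1.1 i ^ (-α) := by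
    simpa [ae_iff] using measure_lifetimeReal_eq hα hν (c σ / σ.1.1 i ^ (-α))
  filter_upwards [hne] with ζ hζ heq
  simp only [branch, resampleChild_fst, resampleChild_snd_self, hinv] at heq ⊢
  by_contra h
  have hweight : σ.1.1 i ^ (-α) ≠ 0 := fun h0 => h (by rw [← heq, h0, zero_mul])
  exact hζ (by rw [← heq, mul_div_cancel_left₀ _ hweight])

lemma ae_branch_eq_const_imp (hα : α < 0) (hν : ν {s | (s : ℕ → ℝ) = Pi.single 0 1} = 0) (x : ℝ) :
    ∀ᵐ σ ∂splitLaw ν, ∀ i, branch α σ i = x → x = 0 :=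
  ae_all_iff.2 fun i => ae_branch_eq_imp hα hν i measurable_const fun _ _ => rfl

lemma ae_branch_eq_branch_imp (hα : α < 0) (hν : ν {s | (s : ℕ → ℝ) = Pi.single 0 1} = 0) :
    ∀ᵐ σ ∂splitLaw ν, ∀ i j, i ≠ j → branch α σ i = branch α σ j → branch α σ j = 0 := by
  refine ae_all_iff.2 fun i => ae_all_iff.2 fun j => ?_
  refine Filter.eventually_imp_distrib_left.2 fun hij => ?_
  refine ae_branch_eq_imp hα hν i (measurable_branch α j) fun σ ζ => ?_
  simp [branch, resampleChild_snd_of_ne hij.symm]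

lemma exists_eq_iSup_of_tsum_rpow_lt_top {f : ℕ → ℝ≥0∞} {p : ℝ} (hp : 0 < p)
    (h : ∑' i, f i ^ p < ∞) : ∃ i, f i = ⨆ i, f i := by
  suffices ∃ i, ∀ j, f j ≤ f i from this.imp fun i hi => (le_iSup f i).antisymm (iSup_le hi)
  by_cases hzero : ∀ i, f i = 0
  · exact ⟨0, fun j => by simp [hzero]⟩
  obtain ⟨k, hk⟩ := not_forall.1 hzero
  refine continuous_of_discreteTopology.exists_forall_ge' k ?_
  have hpos : 0 < f k ^ p := ENNReal.rpow_pos_of_nonneg (pos_iff_ne_zero.2 hk) hp.le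
  rw [Filter.cocompact_eq_cofinite]
  filter_upwards [(ENNReal.tendsto_cofinite_zero_of_tsum_ne_top h.ne).eventually_lt_const hpos]
    with i hi
  exact (ENNReal.rpow_le_rpow_iff hp).1 hi.le

lemma exists_branch_eq (hα : α < 0) {σ : Split}
    (h : weightedSum α (fun ξ => lifetime α ξ ^ (1 - α⁻¹)) σ < ∞) :
    ∃ i, branch α σ i = residualReal α σ := by
  have hp : 0 < 1 - α⁻¹ := zero_lt_one.trans (one_lt_one_sub_inv hα)
  obtain ⟨i, hi⟩ := exists_eq_iSup_of_tsum_rpow_lt_top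
    (f := fun i => ENNReal.ofReal (σ.1.1 i ^ (-α)) * lifetime α (σ.2 i)) hp <| by
      simpa only [ENNReal.mul_rpow_of_nonneg _ _ hp.le, ofReal_rpow_neg_rpow hα (σ.1.2.2.1 _),
        weightedSum] using h
  exact ⟨i, by rw [branch_eq_toReal, hi]; rfl⟩

lemma ae_weightedSum_lifetime_rpow_lt_top (hα : α < 0)
    (hν : ν {s | (s : ℕ → ℝ) = Pi.single 0 1} = 0) :
    ∀ᵐ σ ∂splitLaw ν, weightedSum α (fun ξ => lifetime α ξ ^ (1 - α⁻¹)) σ < ∞ := by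
  refine ae_lt_top (by fun_prop) ?_
  rw [lintegral_weightedSum (by fun_prop)]
  exact ENNReal.mul_ne_top ((powerSum_lt_one hα hν).trans ENNReal.one_lt_top).ne
    (lintegral_lifetime_rpow_lt_top hα hν).ne

lemma measure_residualReal_eq (hα : α < 0) (hν : ν {s | (s : ℕ → ℝ) = Pi.single 0 1} = 0)
    {x : ℝ} (hx : 0 < x) : splitLaw ν {σ | residualReal α σ = x} = 0 := by
  rw [measure_eq_zero_iff_ae_notMem]
  filter_upwards [ae_branch_eq_const_imp hα hν x, ae_weightedSum_lifetime_rpow_lt_top hα hν]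
    with σ hties hsum heq
  obtain ⟨i, hi⟩ := exists_branch_eq hα hsum
  exact hx.ne' (hties i (hi.trans heq))

lemma continuousOn_extinctionDensity (hα : α < 0)
    (hν : ν {s | (s : ℕ → ℝ) = Pi.single 0 1} = 0) :
    ContinuousOn (extinctionDensity α ν) (Set.Ioi 0) :=
  continuousOn_tiltDensity (measurable_residualReal α) fun _ hx => measure_residualReal_eq hα hν hx

end ExtinctionTime

section Positivity

lemma expMeasure_Iic_ne_zero {t : ℝ} (ht : 0 < t) : expMeasure 1 (Set.Iic t) ≠ 0 := by
  rw [← ofReal_cdf, cdf_expMeasure_eq one_pos]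
  simpa [ht.le] using ht

lemma exists_lt_measure_lt_ne_zero {Ω : Type*} [MeasurableSpace Ω] {μ : Measure Ω} [NeZero μ]
    {f : Ω → ℝ≥0∞} {b : ℝ≥0∞} (h : ∀ᵐ ω ∂μ, f ω < b) : ∃ c < b, μ {ω | f ω < c} ≠ 0 := by
  obtain ⟨ω, hω⟩ := h.exists
  obtain ⟨u, -, hu, htendsto⟩ := exists_seq_strictMono_tendsto' (zero_le.trans_lt hω)
  by_contra! hnull
  have hle : ∀ᵐ ω ∂μ, ∀ n, u n ≤ f ω := ae_all_iff.2 fun n => by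
    simpa [ae_iff] using hnull (u n) (hu n).2
  obtain ⟨ω, hlt, hle⟩ := (h.and hle).exists
  exact hlt.not_ge (le_of_tendsto' htendsto hle)

variable {α : ℝ} {ν : Measure massPartitions} [IsProbabilityMeasure ν]

lemma measure_lifetime_lt_ne_zero {a b : ℝ≥0∞} (hab : a < b)
    (h : splitLaw ν {σ | residualLifetime α σ ≤ a} ≠ 0) :
    marksLaw ν {ξ | lifetime α ξ < b} ≠ 0 := by
  obtain ⟨r, hr, hlt⟩ := ENNReal.lt_iff_exists_add_pos_lt.1 hab
  have hmeas : MeasurableSet (Set.Iic (r : ℝ) ×ˢ {σ : Split | residualLifetime α σ ≤ a}) :=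
    measurableSet_Iic.prod (measurableSet_le (by fun_prop) measurable_const)
  intro hzero
  refine mul_ne_zero (expMeasure_Iic_ne_zero (NNReal.coe_pos.2 hr)) h ?_
  rw [← Measure.prod_prod, ← (measurePreserving_clock_split ν).measure_preimage
    hmeas.nullMeasurableSet]
  refine measure_mono_null (fun ξ ⟨hclock, hres⟩ => ?_) hzero
  rw [Set.mem_ofPred_eq, lifetime_eq, add_comm]
  refine (add_le_add hres ?_).trans_lt hlt
  exact ENNReal.ofReal_le_of_le_toReal hclock

omit [IsProbabilityMeasure ν] in
lemma measure_lt_rpow_mul_lifetime_le (hα : α < 0) {x : ℝ} (hx : 0 ≤ x) {y : ℝ≥0∞}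
    (hy0 : y ≠ 0) (hy : y ≠ ∞) :
    marksLaw ν {ξ | y < ENNReal.ofReal (x ^ (-α)) * lifetime α ξ} ≤
      ENNReal.ofReal (x ^ (1 - α)) *
        ((∫⁻ ξ, lifetime α ξ ^ (1 - α⁻¹) ∂marksLaw ν) / y ^ (1 - α⁻¹)) := by
  have hp : 0 < 1 - α⁻¹ := zero_lt_one.trans (one_lt_one_sub_inv hα)
  rw [← mul_div_assoc, ← lintegral_const_mul _ (by fun_prop)]
  refine le_trans (measure_mono fun ξ hξ => ?_) <| meas_ge_le_lintegral_div (by fun_prop)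
    (ENNReal.rpow_pos (pos_iff_ne_zero.2 hy0) hy).ne' (ENNReal.rpow_lt_top_of_nonneg hp.le hy).ne
  rw [Set.mem_ofPred_eq, ← ofReal_rpow_neg_rpow hα hx, ← ENNReal.mul_rpow_of_nonneg _ _ hp.le]
  exact ENNReal.rpow_le_rpow (le_of_lt hξ) hp.le

lemma infinitePi_forall_rpow_mul_lifetime_le_ne_zero (hα : α < 0)
    (hν : ν {s | (s : ℕ → ℝ) = Pi.single 0 1} = 0) {s : massPartitions} {c y : ℝ≥0∞}
    (hs : ENNReal.ofReal (s.1 0 ^ (-α)) ≤ c) (hc : c ≠ ∞) (hy : y ≠ ∞)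
    (h : marksLaw ν {ξ | lifetime α ξ < y} ≠ 0) :
    Measure.infinitePi (fun _ : ℕ => marksLaw ν)
      {η | ∀ j, ENNReal.ofReal (s.1 j ^ (-α)) * lifetime α (η j) ≤ c * y} ≠ 0 := by
  have hy0 : y ≠ 0 := by rintro rfl; simp at h
  have hc0 : c ≠ 0 := fun h0 => (Real.rpow_pos_of_pos (head_pos s) (-α)).not_ge <| by
    simpa [h0] using hs
  have hle (j : ℕ) : ENNReal.ofReal (s.1 j ^ (-α)) ≤ c := hs.trans' <|
    ENNReal.ofReal_le_ofReal (Real.rpow_le_rpow (s.2.2.1 j) (s.2.1 j.zero_le) (by linarith))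
  have hpi := infinitePi_pi_univ_ne_zero (fun _ : ℕ => marksLaw ν)
    (t := fun j => {ξ | ENNReal.ofReal (s.1 j ^ (-α)) * lifetime α ξ ≤ c * y})
    (fun j => measurableSet_le (by fun_prop) measurable_const)
    (fun j h0 => h (measure_mono_null (fun ξ hξ => mul_le_mul' (hle j) (le_of_lt hξ)) h0)) ?_
  · convert hpi using 2
    ext η
    simp
  · simp only [Set.compl_ofPred, not_le]
    refine ne_top_of_le_ne_top ?_ (ENNReal.tsum_le_tsum fun j =>
      measure_lt_rpow_mul_lifetime_le hα (s.2.2.1 j) (mul_ne_zero hc0 hy0)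
        (ENNReal.mul_ne_top hc hy))
    rw [ENNReal.tsum_mul_right]
    refine ENNReal.mul_ne_top (ne_top_of_le_ne_top ENNReal.ofReal_ne_top
      (tsum_rpow_le_head_rpow hα s)) ?_
    exact ENNReal.div_ne_top (lintegral_lifetime_rpow_lt_top hα hν).ne
      (ENNReal.rpow_pos (pos_iff_ne_zero.2 (mul_ne_zero hc0 hy0)) (ENNReal.mul_ne_top hc hy)).ne'

lemma measure_residualLifetime_le_ne_zero (hα : α < 0)
    (hν : ν {s | (s : ℕ → ℝ) = Pi.single 0 1} = 0) {c y : ℝ≥0∞} (hc : c ≠ ∞) (hy : y ≠ ∞)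
    (hhead : ν {s | ENNReal.ofReal (s.1 0 ^ (-α)) < c} ≠ 0)
    (h : marksLaw ν {ξ | lifetime α ξ < y} ≠ 0) :
    splitLaw ν {σ | residualLifetime α σ ≤ c * y} ≠ 0 := by
  rw [Ne, Measure.measure_prod_null (measurableSet_le (by fun_prop) measurable_const)]
  intro hnull
  refine hhead (measure_mono_null (fun s hs => ?_) (ae_iff.1 hnull))
  simpa [residualLifetime, weightedSup, Set.preimage] using
    infinitePi_forall_rpow_mul_lifetime_le_ne_zero hα hν (le_of_lt hs) hc hy h

lemma measure_residualReal_lt_ne_zero (hα : α < 0)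
    (hν : ν {s | (s : ℕ → ℝ) = Pi.single 0 1} = 0) {x : ℝ} (hx : 0 < x) :
    splitLaw ν {σ | residualReal α σ < x} ≠ 0 := by
  have hhead : ∀ᵐ s ∂ν, ENNReal.ofReal (s.1 0 ^ (-α)) < 1 := by
    filter_upwards [ae_head_lt_one hν] with s hs
    exact ENNReal.ofReal_lt_one.2 (Real.rpow_lt_one (s.2.2.1 0) hs (by linarith))
  obtain ⟨c, hc1, hc⟩ := exists_lt_measure_lt_ne_zero hhead
  obtain ⟨y, hy, hlt⟩ := exists_lt_measure_lt_ne_zero (ae_lifetime_lt_top hα hν)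
  obtain ⟨d, hcd, hd1⟩ := exists_between hc1
  have hd (n : ℕ) : d ^ n * y ≠ ∞ := (ENNReal.mul_lt_top (ENNReal.pow_lt_top hd1.lt_top) hy).ne
  have hresidual {z : ℝ≥0∞} (hz : z ≠ ∞) (h : marksLaw ν {ξ | lifetime α ξ < z} ≠ 0) :=
    measure_residualLifetime_le_ne_zero hα hν hc1.ne_top hz hc h
  have hlifetime (n : ℕ) : marksLaw ν {ξ | lifetime α ξ < d ^ n * y} ≠ 0 := by
    induction n with
    | zero => simpa using hlt
    | succ n ih =>
      have hne : d ^ n * y ≠ 0 := fun h0 => by simp [h0] at ih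
      rw [pow_succ', mul_assoc]
      exact measure_lifetime_lt_ne_zero
        ((ENNReal.mul_lt_mul_iff_left hne (hd n)).2 hcd) (hresidual (hd n) ih)
  have htendsto : Filter.Tendsto (fun n => d ^ n * y) Filter.atTop (nhds 0) := by
    simpa using ENNReal.Tendsto.mul_const
      (ENNReal.tendsto_pow_atTop_nhds_zero_of_lt_one hd1) (Or.inr hy.ne)
  obtain ⟨n, hn⟩ := (htendsto.eventually_lt_const (ENNReal.ofReal_pos.2 hx)).exists
  refine fun h0 => hresidual (hd n) (hlifetime n) (measure_mono_null (fun σ hσ => ?_) h0)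
  refine ENNReal.toReal_lt_of_lt_ofReal (lt_of_le_of_lt ?_ hn)
  exact (show residualLifetime α σ ≤ c * (d ^ n * y) from hσ).trans (mul_le_of_le_one_left' hc1.le)

lemma tiltMass_residualReal_ne_zero (hα : α < 0)
    (hν : ν {s | (s : ℕ → ℝ) = Pi.single 0 1} = 0) (x : ℝ) (hx : 0 < x) :
    tiltMass (splitLaw ν) (residualReal α) x ≠ 0 :=
  tiltMass_ne_zero (measurable_residualReal α) (measure_residualReal_lt_ne_zero hα hν hx)

lemma extinctionDensity_pos (hα : α < 0) (hν : ν {s | (s : ℕ → ℝ) = Pi.single 0 1} = 0) {x : ℝ}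
    (hx : 0 < x) : 0 < extinctionDensity α ν x :=
  mul_pos (Real.exp_pos _)
    (ENNReal.toReal_pos (tiltMass_residualReal_ne_zero hα hν x hx) (tiltMass_ne_top x))

end Positivity

section Genealogy

variable {α : ℝ} {ξ : Marks}

lemma mass_nonneg (ξ : Marks) (u : List ℕ) : 0 ≤ mass ξ u := by
  induction u with
  | nil => exact zero_le_one
  | cons i u ih => exact mul_nonneg ih ((ξ u).2.2.2.1 i)

lemma mass_le_one (ξ : Marks) (u : List ℕ) : mass ξ u ≤ 1 := by
  induction u with
  | nil => exact le_rfl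
  | cons i u ih => exact mul_le_one₀ ih ((ξ u).2.2.2.1 i) (le_one_of_massPartitions (ξ u).2 i)

lemma mass_append (ξ : Marks) (u v : List ℕ) :
    mass ξ (v ++ u) = mass ξ u * mass (subtree u ξ) v := by
  induction v with
  | nil => simp [mass]
  | cons i v ih => rw [List.cons_append, mass, mass, ih, subtree, mul_assoc]

lemma mass_singleton (ξ : Marks) (i : ℕ) : mass ξ [i] = (split ξ).1.1 i := by
  simp [mass, split]

lemma mass_cons (ξ : Marks) (i : ℕ) (u : List ℕ) :
    mass ξ (i :: u) = mass ξ u * (split (subtree u ξ)).1.1 i := by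
  rw [← mass_singleton, ← mass_append, List.singleton_append]

lemma birth_append (α : ℝ) (ξ : Marks) (u v : List ℕ) :
    birth α ξ (v ++ u) = birth α ξ u + mass ξ u ^ (-α) * birth α (subtree u ξ) v := by
  induction v with
  | nil => simp [birth]
  | cons i v ih =>
    rw [List.cons_append, birth, birth, ih, mass_append,
      Real.mul_rpow (mass_nonneg _ _) (mass_nonneg _ _)]
    simp only [subtree]
    ring

lemma splitTime_append (α : ℝ) (ξ : Marks) (u v : List ℕ) :
    splitTime α ξ (v ++ u) = birth α ξ u + mass ξ u ^ (-α) * splitTime α (subtree u ξ) v :=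
  birth_append α ξ u (0 :: v)

lemma splitTime_nil (α : ℝ) (ξ : Marks) : splitTime α ξ [] = (ξ []).1 := by
  simp [splitTime, birth, mass]

lemma birth_le_splitTime (hclock : ∀ u, 0 < (ξ u).1) (u : List ℕ) :
    birth α ξ u ≤ splitTime α ξ u :=
  le_add_of_nonneg_right (mul_nonneg (Real.rpow_nonneg (mass_nonneg _ _) _) (hclock u).le)

lemma birth_le_birth_append (hclock : ∀ u, 0 < (ξ u).1) (u v : List ℕ) :
    birth α ξ u ≤ birth α ξ (v ++ u) := by
  induction v with
  | nil => exact le_rfl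
  | cons i v ih => exact ih.trans (birth_le_splitTime hclock (v ++ u))

lemma mass_pos_of_present (hα : α < 0) {u : List ℕ} {t : ℝ} (h : Present α ξ u t) :
    0 < mass ξ u := by
  refine (mass_nonneg ξ u).lt_of_ne' fun hzero => (h.1.trans_lt h.2).ne ?_
  rw [splitTime, hzero, Real.zero_rpow (neg_ne_zero.2 hα.ne), zero_mul, add_zero]

lemma present_append_iff {u v : List ℕ} {t : ℝ} (hu : 0 < mass ξ u) :
    Present α ξ (v ++ u) t ↔
      Present α (subtree u ξ) v ((t - birth α ξ u) / mass ξ u ^ (-α)) := by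
  have hm : 0 < mass ξ u ^ (-α) := Real.rpow_pos_of_pos hu _
  rw [Present, Present, birth_append, splitTime_append, le_div_iff₀' hm, div_lt_iff₀' hm,
    le_sub_iff_add_le', sub_lt_iff_lt_add']

lemma ofReal_splitTime_le_lifetime (u : List ℕ) :
    ENNReal.ofReal (splitTime α ξ u) ≤ lifetime α ξ := by
  induction u using List.reverseRecOn generalizing ξ with
  | nil =>
    rw [lifetime_eq, splitTime_nil]
    exact le_self_add
  | append_singleton v i ih =>
    have hbirth : birth α ξ [i] = (ξ []).1 := splitTime_nil α ξ
    rw [splitTime_append, lifetime_eq, mass_singleton, hbirth]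
    refine ENNReal.ofReal_add_le.trans (add_le_add le_rfl ?_)
    rw [ENNReal.ofReal_mul (Real.rpow_nonneg ((split ξ).1.2.2.1 i) _)]
    exact (mul_le_mul' le_rfl ih).trans (le_iSup
      (fun i => ENNReal.ofReal ((split ξ).1.1 i ^ (-α)) * lifetime α ((split ξ).2 i)) i)

lemma exists_present_of_lt_truncatedLifetime (hα : α < 0) (hclock : ∀ u, 0 < (ξ u).1) (n : ℕ)
    {t : ℝ} (ht : 0 ≤ t) (hlt : ENNReal.ofReal t < truncatedLifetime α n ξ) :
    ∃ u, Present α ξ u t := by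
  induction n generalizing ξ t with
  | zero => simp [truncatedLifetime] at hlt
  | succ n ih =>
    rcases lt_or_ge t (ξ []).1 with hroot | hroot
    · exact ⟨[], ht, by rwa [splitTime_nil]⟩
    · have hresidual : ENNReal.ofReal (t - (ξ []).1) <
          weightedSup α (truncatedLifetime α n) (split ξ) := by
        rw [ENNReal.ofReal_sub _ (hclock []).le]
        exact ENNReal.sub_lt_of_lt_add (ENNReal.ofReal_le_ofReal hroot) (by rwa [add_comm])
      obtain ⟨i, hi⟩ := lt_iSup_iff.1 hresidual
      have hpow : 0 < (split ξ).1.1 i ^ (-α) :=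
        ENNReal.ofReal_pos.1 (CanonicallyOrderedAdd.mul_pos.1 (bot_le.trans_lt hi)).1
      have hmass : 0 < mass ξ [i] := by
        rw [mass_singleton]
        refine ((split ξ).1.2.2.1 i).lt_of_ne' fun hzero => hpow.ne' ?_
        rw [hzero, Real.zero_rpow (neg_ne_zero.2 hα.ne)]
      obtain ⟨v, hv⟩ := ih (ξ := subtree [i] ξ) (t := (t - (ξ []).1) / (split ξ).1.1 i ^ (-α))
        (fun v => hclock (v ++ [i])) (div_nonneg (sub_nonneg.2 hroot) hpow.le) (by
          rw [ENNReal.ofReal_div_of_pos hpow]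
          exact ENNReal.div_lt_of_lt_mul' hi)
      refine ⟨v ++ [i], (present_append_iff hmass).2 ?_⟩
      rwa [mass_singleton, show birth α ξ [i] = (ξ []).1 from splitTime_nil α ξ]

lemma exists_present_iff (hα : α < 0) (hclock : ∀ u, 0 < (ξ u).1) {t : ℝ} (ht : 0 ≤ t) :
    (∃ u, Present α ξ u t) ↔ ENNReal.ofReal t < lifetime α ξ := by
  constructor
  · rintro ⟨u, hu⟩
    exact ((ENNReal.ofReal_lt_ofReal_iff_of_nonneg ht).2 hu.2).trans_le
      (ofReal_splitTime_le_lifetime u)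
  · intro hlt
    obtain ⟨n, hn⟩ := lt_iSup_iff.1 hlt
    exact exists_present_of_lt_truncatedLifetime hα hclock n ht hn

end Genealogy

section Extinction

lemma decreasingRearrangement_eq_zero_iff {ι : Type*} [Infinite ι] {a : ι → ℝ} {c : ℝ}
    (hnonneg : ∀ i, 0 ≤ a i) (hle : ∀ i, a i ≤ c) :
    decreasingRearrangement a = 0 ↔ a = 0 := by
  constructor
  · intro h
    ext i
    have hbdd : BddAbove {x : ℝ | ((0 + 1 : ℕ) : ℕ∞) ≤ {i | x ≤ a i}.encard} := by
      refine ⟨c, fun x hx => ?_⟩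
      rw [Set.mem_ofPred_eq, zero_add, Nat.cast_one, Set.one_le_encard_iff_nonempty] at hx
      obtain ⟨j, hj⟩ := hx
      exact le_trans hj (hle j)
    have hmem : a i ∈ {x : ℝ | ((0 + 1 : ℕ) : ℕ∞) ≤ {i | x ≤ a i}.encard} := by
      rw [Set.mem_ofPred_eq, zero_add, Nat.cast_one, Set.one_le_encard_iff_nonempty]
      exact ⟨i, le_refl (a i)⟩
    exact ((le_csSup hbdd hmem).trans_eq (congrFun h 0)).antisymm (hnonneg i)
  · rintro rfl
    ext n
    refine IsGreatest.csSup_eq ⟨by simp, fun x hx => ?_⟩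
    by_contra! hpos
    have hempty : {i : ι | x ≤ (0 : ι → ℝ) i} = ∅ :=
      Set.eq_empty_of_forall_notMem fun _ hi => hpos.not_ge hi
    rw [Set.mem_ofPred_eq, hempty] at hx
    simp at hx

variable {α : ℝ} {ξ : Marks}

lemma fragmentsOf_eq_zero_iff (hα : α < 0) {u : List ℕ} {t : ℝ} :
    fragmentsOf α ξ u t = 0 ↔ ∀ v, ¬ Present α ξ (v ++ u) t := by
  rw [fragmentsOf, decreasingRearrangement_eq_zero_iff (c := 1)
    (fun v => by split_ifs; exacts [mass_nonneg ξ v, le_rfl])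
    (fun v => by split_ifs; exacts [mass_le_one ξ v, zero_le_one]), funext_iff]
  constructor
  · intro h v hv
    have hterm := h (v ++ u)
    rw [if_pos ⟨List.suffix_append v u, hv⟩] at hterm
    exact (mass_pos_of_present hα hv).ne' hterm
  · rintro h _
    exact if_neg fun ⟨⟨v, hv⟩, hp⟩ => h v (hv ▸ hp)

/-- The time at which the last descendant of the block `u` disappears. -/
def deathTime (α : ℝ) (ξ : Marks) (u : List ℕ) : ℝ :=
  birth α ξ u + mass ξ u ^ (-α) * lifetimeReal α (subtree u ξ)

lemma deathTime_nil (α : ℝ) (ξ : Marks) : deathTime α ξ [] = lifetimeReal α ξ := by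
  simp [deathTime, birth, mass]

lemma deathTime_cons (i : ℕ) (u : List ℕ) :
    deathTime α ξ (i :: u) =
      splitTime α ξ u + mass ξ u ^ (-α) * branch α (split (subtree u ξ)) i := by
  rw [deathTime, mass_cons, Real.mul_rpow (mass_nonneg _ _) ((split _).1.2.2.1 i), mul_assoc,
    subtree_cons]
  rfl

lemma fragmentsOf_eq_zero_iff_deathTime_le (hα : α < 0) (hclock : ∀ u, 0 < (ξ u).1) {u : List ℕ}
    {t : ℝ} (hu : 0 < mass ξ u) (hfin : lifetime α (subtree u ξ) < ∞) (ht : birth α ξ u ≤ t) :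
    fragmentsOf α ξ u t = 0 ↔ deathTime α ξ u ≤ t := by
  have hm : 0 < mass ξ u ^ (-α) := Real.rpow_pos_of_pos hu _
  have hage : 0 ≤ (t - birth α ξ u) / mass ξ u ^ (-α) := div_nonneg (sub_nonneg.2 ht) hm.le
  simp_rw [fragmentsOf_eq_zero_iff hα, present_append_iff hu]
  rw [← not_exists, exists_present_iff (ξ := subtree u ξ) hα (fun v => hclock (v ++ u)) hage,
    not_lt, ENNReal.le_ofReal_iff_toReal_le hfin.ne hage, le_div_iff₀' hm, le_sub_iff_add_le',
    deathTime, lifetimeReal]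

lemma residualExtinctionTime_eq (hα : α < 0) (hclock : ∀ u, 0 < (ξ u).1) {u : List ℕ} {t : ℝ}
    (hu : 0 < mass ξ u) (hfin : lifetime α (subtree u ξ) < ∞) (ht : birth α ξ u ≤ t)
    (ht' : t ≤ deathTime α ξ u) : residualExtinctionTime α ξ u t = deathTime α ξ u - t := by
  have hset : {s | 0 ≤ s ∧ fragmentsOf α ξ u (t + s) = 0} = Set.Ici (deathTime α ξ u - t) := by
    ext s
    rw [Set.mem_ofPred_eq, Set.mem_Ici, sub_le_iff_le_add']
    have hiff (hs : 0 ≤ s) := fragmentsOf_eq_zero_iff_deathTime_le hα hclock hu hfin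
      (ht.trans (le_add_of_nonneg_right hs))
    constructor
    · rintro ⟨hs, hzero⟩
      exact (hiff hs).1 hzero
    · intro hle
      have hs : 0 ≤ s := by linarith
      exact ⟨hs, (hiff hs).2 hle⟩
  rw [residualExtinctionTime, hset, csInf_Ici]

lemma extinctionTime_eq_lifetimeReal (hα : α < 0) (hclock : ∀ u, 0 < (ξ u).1)
    (hfin : lifetime α ξ < ∞) : extinctionTime α ξ = lifetimeReal α ξ := by
  have hres := residualExtinctionTime_eq hα hclock (u := []) (t := 0) (by simp [mass])
    (by simpa using hfin) le_rfl ((lifetimeReal_nonneg α ξ).trans_eq (deathTime_nil α ξ).symm)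
  rw [deathTime_nil, sub_zero] at hres
  rw [← hres, extinctionTime, residualExtinctionTime]
  simp only [fragmentation, zero_add]

lemma splitTime_le_deathTime {u : List ℕ} (hfin : lifetime α (subtree u ξ) < ∞) :
    splitTime α ξ u ≤ deathTime α ξ u := by
  have hclock := ofReal_splitTime_le_lifetime (α := α) (ξ := subtree u ξ) []
  rw [splitTime_nil, ENNReal.ofReal_le_iff_le_toReal hfin.ne] at hclock
  exact add_le_add le_rfl
    (mul_le_mul_of_nonneg_left hclock (Real.rpow_nonneg (mass_nonneg _ _) _))

end Extinction

section LastChild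

variable {α : ℝ} {σ : Split}

/-- The almost sure properties of the first split: it is not trivial, the family of the extinction
times of the sub-blocks tends to `0`, and its positive terms are distinct. -/
structure RegularSplit (α : ℝ) (σ : Split) : Prop where
  head_lt_one : σ.1.1 0 < 1
  residualLifetime_lt_top : residualLifetime α σ < ∞
  weightedSum_lt_top : weightedSum α (fun ξ => lifetime α ξ ^ (1 - α⁻¹)) σ < ∞
  lifetimeReal_head_ne_zero : lifetimeReal α (σ.2 0) ≠ 0
  branch_eq_zero_of_eq : ∀ i j, i ≠ j → branch α σ i = branch α σ j → branch α σ j = 0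

/-- The rank of the sub-block of the initial block that becomes extinct last. -/
def lastChild (α : ℝ) (σ : Split) : ℕ := sInf {i | residualReal α σ ≤ branch α σ i}

namespace RegularSplit

lemma mass_lt_one (h : RegularSplit α σ) (i : ℕ) : σ.1.1 i < 1 :=
  (σ.1.2.1 (Nat.zero_le i)).trans_lt h.head_lt_one

lemma branch_le (h : RegularSplit α σ) (i : ℕ) : branch α σ i ≤ residualReal α σ := by
  rw [branch_eq_toReal]
  exact ENNReal.toReal_mono h.residualLifetime_lt_top.ne
    (le_iSup (fun i => ENNReal.ofReal (σ.1.1 i ^ (-α)) * lifetime α (σ.2 i)) i)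

lemma residualReal_pos (h : RegularSplit α σ) : 0 < residualReal α σ :=
  (mul_pos (Real.rpow_pos_of_pos (head_pos σ.1) _)
    ((lifetimeReal_nonneg α _).lt_of_ne' h.lifetimeReal_head_ne_zero)).trans_le (h.branch_le 0)

lemma branch_lastChild (hα : α < 0) (h : RegularSplit α σ) :
    branch α σ (lastChild α σ) = residualReal α σ := by
  obtain ⟨i, hi⟩ := exists_branch_eq hα h.weightedSum_lt_top
  exact (h.branch_le _).antisymm (Nat.sInf_mem (s := {i | residualReal α σ ≤ branch α σ i})
    ⟨i, hi.ge⟩)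

lemma branch_lt (hα : α < 0) (h : RegularSplit α σ) {i : ℕ} (hi : i ≠ lastChild α σ) :
    branch α σ i < residualReal α σ := by
  refine (h.branch_le i).lt_of_ne fun heq => h.residualReal_pos.ne' ?_
  rw [← h.branch_lastChild hα] at heq ⊢
  exact h.branch_eq_zero_of_eq _ _ hi heq

lemma lastChild_eq_iff (hα : α < 0) (h : RegularSplit α σ) {i : ℕ} :
    lastChild α σ = i ↔ ∀ j, j ≠ i → branch α σ j < branch α σ i := by
  constructor
  · rintro rfl j hj
    rw [h.branch_lastChild hα]
    exact h.branch_lt hα hj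
  · intro hlt
    by_contra hne
    exact (hlt _ hne).not_ge ((h.branch_le i).trans_eq (h.branch_lastChild hα).symm)

lemma mass_lastChild_pos (hα : α < 0) (h : RegularSplit α σ) : 0 < σ.1.1 (lastChild α σ) := by
  refine (σ.1.2.2.1 _).lt_of_ne' fun hzero => h.residualReal_pos.ne' ?_
  rw [← h.branch_lastChild hα, branch, hzero, Real.zero_rpow (neg_ne_zero.2 hα.ne), zero_mul]

end RegularSplit

lemma ae_regularSplit {ν : Measure massPartitions} [IsProbabilityMeasure ν] (hα : α < 0)
    (hν : ν {s | (s : ℕ → ℝ) = Pi.single 0 1} = 0) : ∀ᵐ σ ∂splitLaw ν, RegularSplit α σ := by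
  have hfin : ∀ᵐ σ ∂splitLaw ν, residualLifetime α σ < ∞ := by
    rw [← (measurePreserving_split ν).map_eq, ae_map_iff measurable_split.aemeasurable
      (measurableSet_lt (by fun_prop) measurable_const)]
    filter_upwards [ae_lifetime_lt_top hα hν] with ξ hξ using residualLifetime_lt_top hξ
  have hhead : ∀ᵐ σ ∂splitLaw ν, lifetimeReal α (σ.2 0) ≠ 0 :=
    (measurePreserving_split_child ν 0).quasiMeasurePreserving.ae
      (measure_eq_zero_iff_ae_notMem.1 (measure_lifetimeReal_eq hα hν 0))
  filter_upwards [Measure.quasiMeasurePreserving_fst.ae (ae_head_lt_one hν), hfin,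
    ae_weightedSum_lifetime_rpow_lt_top hα hν, hhead, ae_branch_eq_branch_imp hα hν]
    with σ hlt hfin hsum hhead hties
  exact ⟨hlt, hfin, hsum, hhead, hties⟩

end LastChild

section Spine

variable {α : ℝ} {ξ : Marks}

/-- The almost sure properties of the marks of the blocks. -/
structure Regular (α : ℝ) (ξ : Marks) : Prop where
  clock_pos : ∀ u, 0 < (ξ u).1
  lifetime_lt_top : ∀ u, lifetime α (subtree u ξ) < ∞
  regularSplit : ∀ u, RegularSplit α (split (subtree u ξ))
  tsum_generationSum_lt_top : ∑' n, generationSum α n ξ < ∞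

lemma ae_regular {ν : Measure massPartitions} [IsProbabilityMeasure ν] (hα : α < 0)
    (hν : ν {s | (s : ℕ → ℝ) = Pi.single 0 1} = 0) : ∀ᵐ ξ ∂marksLaw ν, Regular α ξ := by
  have hsubtree {p : Marks → Prop} (hp : ∀ᵐ ξ ∂marksLaw ν, p ξ) :
      ∀ᵐ ξ ∂marksLaw ν, ∀ u, p (subtree u ξ) :=
    ae_all_iff.2 fun u => (measurePreserving_subtree _ u).quasiMeasurePreserving.ae hp
  filter_upwards [
    hsubtree ((measurePreserving_clock ν).quasiMeasurePreserving.ae ae_pos_expMeasure),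
    hsubtree (ae_lifetime_lt_top hα hν),
    hsubtree ((measurePreserving_split ν).quasiMeasurePreserving.ae (ae_regularSplit hα hν)),
    ae_tsum_generationSum_lt_top hα hν] with ξ hclock hfin hsplit hsum
  exact ⟨hclock, hfin, hsplit, hsum⟩

/-- The successive labels of the last block. -/
def spine (α : ℝ) (ξ : Marks) : ℕ → List ℕ
  | 0 => []
  | n + 1 => lastChild α (split (subtree (spine α ξ n) ξ)) :: spine α ξ n

lemma length_spine (α : ℝ) (ξ : Marks) (n : ℕ) : (spine α ξ n).length = n := by
  induction n with
  | zero => rfl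
  | succ n ih => rw [spine, List.length_cons, ih]

lemma mass_rpow_mul_generationSum_le (n : ℕ) (u : List ℕ) :
    ENNReal.ofReal (mass ξ u ^ (1 - α)) * generationSum α n (subtree u ξ) ≤
      generationSum α (n + u.length) ξ := by
  induction u generalizing n with
  | nil => simp [mass]
  | cons i u ih =>
    rw [mass_cons, Real.mul_rpow (mass_nonneg _ _) ((split _).1.2.2.1 i),
      ENNReal.ofReal_mul (Real.rpow_nonneg (mass_nonneg _ _) _), mul_assoc, subtree_cons,
      List.length_cons, ← add_assoc, add_right_comm]
    refine (mul_le_mul' le_rfl ?_).trans (ih (n + 1))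
    exact ENNReal.le_tsum (f := fun i => ENNReal.ofReal ((split (subtree u ξ)).1.1 i ^ (1 - α)) *
      generationSum α n ((split (subtree u ξ)).2 i)) i

lemma eq_or_exists_append_cons_of_suffix {β : Type*} {u v : List β} (h : u <:+ v) :
    v = u ∨ ∃ w i, v = w ++ i :: u := by
  obtain ⟨w, rfl⟩ := h
  rcases List.eq_nil_or_concat w with rfl | ⟨w, i, rfl⟩
  · exact Or.inl rfl
  · exact Or.inr ⟨w, i, by simp⟩

namespace Regular

lemma lifetimeReal_subtree_eq (h : Regular α ξ) (u : List ℕ) :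
    lifetimeReal α (subtree u ξ) = (ξ u).1 + residualReal α (split (subtree u ξ)) :=
  lifetimeReal_eq (ξ := subtree u ξ) (h.clock_pos u) (h.lifetime_lt_top u)

lemma lifetimeReal_pos (h : Regular α ξ) (u : List ℕ) : 0 < lifetimeReal α (subtree u ξ) := by
  rw [h.lifetimeReal_subtree_eq]
  exact add_pos (h.clock_pos u) (h.regularSplit u).residualReal_pos

lemma mass_spine_pos (hα : α < 0) (h : Regular α ξ) (n : ℕ) : 0 < mass ξ (spine α ξ n) := by
  induction n with
  | zero => exact zero_lt_one
  | succ n ih =>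
    rw [spine, mass_cons]
    exact mul_pos ih ((h.regularSplit _).mass_lastChild_pos hα)

lemma mass_spine_succ_lt (hα : α < 0) (h : Regular α ξ) (n : ℕ) :
    mass ξ (spine α ξ (n + 1)) < mass ξ (spine α ξ n) := by
  rw [spine, mass_cons]
  exact mul_lt_of_lt_one_right (h.mass_spine_pos hα n) ((h.regularSplit _).mass_lt_one _)

lemma deathTime_eq (h : Regular α ξ) (u : List ℕ) :
    deathTime α ξ u =
      splitTime α ξ u + mass ξ u ^ (-α) * residualReal α (split (subtree u ξ)) := by
  rw [deathTime, h.lifetimeReal_subtree_eq, splitTime]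
  ring

lemma deathTime_spine (hα : α < 0) (h : Regular α ξ) (n : ℕ) :
    deathTime α ξ (spine α ξ n) = lifetimeReal α ξ := by
  induction n with
  | zero => exact deathTime_nil α ξ
  | succ n ih =>
    rw [spine, deathTime_cons, (h.regularSplit _).branch_lastChild hα, ← h.deathTime_eq, ih]

lemma deathTime_append_le (h : Regular α ξ) (u v : List ℕ) :
    deathTime α ξ (v ++ u) ≤ deathTime α ξ u := by
  induction v with
  | nil => exact le_rfl
  | cons i v ih =>
    refine le_trans ?_ ih
    rw [List.cons_append, deathTime_cons, h.deathTime_eq]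
    exact add_le_add le_rfl (mul_le_mul_of_nonneg_left ((h.regularSplit _).branch_le i)
      (Real.rpow_nonneg (mass_nonneg _ _) _))

lemma deathTime_lt_of_ne_lastChild (hα : α < 0) (h : Regular α ξ) (n : ℕ) (v : List ℕ) {i : ℕ}
    (hi : i ≠ lastChild α (split (subtree (spine α ξ n) ξ))) :
    deathTime α ξ (v ++ i :: spine α ξ n) < lifetimeReal α ξ := by
  refine (h.deathTime_append_le _ v).trans_lt ?_
  rw [deathTime_cons, ← h.deathTime_spine hα n, h.deathTime_eq]
  exact add_lt_add_of_le_of_lt le_rfl (mul_lt_mul_of_pos_left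
    ((h.regularSplit _).branch_lt hα hi) (Real.rpow_pos_of_pos (h.mass_spine_pos hα n) _))

lemma spine_suffix_or_eq_or_deathTime_lt (hα : α < 0) (h : Regular α ξ) (n : ℕ) (v : List ℕ) :
    spine α ξ n <:+ v ∨ (∃ k < n, v = spine α ξ k) ∨ deathTime α ξ v < lifetimeReal α ξ := by
  induction n with
  | zero => exact Or.inl List.nil_suffix
  | succ n ih =>
    rcases ih with hsuffix | ⟨k, hk, rfl⟩ | hlt
    · rcases eq_or_exists_append_cons_of_suffix hsuffix with rfl | ⟨w, i, rfl⟩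
      · exact Or.inr (Or.inl ⟨n, n.lt_succ_self, rfl⟩)
      · by_cases hi : i = lastChild α (split (subtree (spine α ξ n) ξ))
        · left
          rw [spine, ← hi]
          exact List.suffix_append _ _
        · exact Or.inr (Or.inr (h.deathTime_lt_of_ne_lastChild hα n w hi))
    · exact Or.inr (Or.inl ⟨k, hk.trans n.lt_succ_self, rfl⟩)
    · exact Or.inr (Or.inr hlt)

lemma birth_spine_lt_succ (hα : α < 0) (h : Regular α ξ) (n : ℕ) :
    birth α ξ (spine α ξ n) < birth α ξ (spine α ξ (n + 1)) :=
  lt_add_of_pos_right _ (mul_pos (Real.rpow_pos_of_pos (h.mass_spine_pos hα n) _) (h.clock_pos _))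

lemma birth_spine_eq (hα : α < 0) (h : Regular α ξ) (n : ℕ) :
    birth α ξ (spine α ξ n) = lifetimeReal α ξ -
      (ENNReal.ofReal (mass ξ (spine α ξ n) ^ (-α)) *
        lifetime α (subtree (spine α ξ n) ξ)).toReal := by
  rw [← h.deathTime_spine hα n, deathTime, ENNReal.toReal_mul,
    ENNReal.toReal_ofReal (Real.rpow_nonneg (mass_nonneg _ _) _), lifetimeReal,
    add_sub_cancel_right]

lemma birth_spine_lt (hα : α < 0) (h : Regular α ξ) (n : ℕ) :
    birth α ξ (spine α ξ n) < lifetimeReal α ξ := by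
  rw [← h.deathTime_spine hα n]
  exact lt_add_of_pos_right _ (mul_pos (Real.rpow_pos_of_pos (h.mass_spine_pos hα n) _)
    (h.lifetimeReal_pos _))

-- The `(1 - α⁻¹)`-th power of the time between the birth of the `n`-th last block and extinction is
-- one of the terms of the `n`-th generation sum.
lemma tendsto_birth_spine (hα : α < 0) (h : Regular α ξ) :
    Filter.Tendsto (fun n => birth α ξ (spine α ξ n)) Filter.atTop (nhds (lifetimeReal α ξ)) := by
  have hp : 0 < 1 - α⁻¹ := zero_lt_one.trans (one_lt_one_sub_inv hα)
  set g : ℕ → ℝ≥0∞ := fun n => ENNReal.ofReal (mass ξ (spine α ξ n) ^ (-α)) *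
    lifetime α (subtree (spine α ξ n) ξ)
  have hle (n : ℕ) : g n ^ (1 - α⁻¹) ≤ generationSum α n ξ := by
    have hgen := mass_rpow_mul_generationSum_le (α := α) (ξ := ξ) 0 (spine α ξ n)
    rw [length_spine, zero_add] at hgen
    rwa [ENNReal.mul_rpow_of_nonneg _ _ hp.le, ofReal_rpow_neg_rpow hα (mass_nonneg _ _)]
  have hpow : Filter.Tendsto (fun n => g n ^ (1 - α⁻¹)) Filter.atTop (nhds 0) :=
    tendsto_of_tendsto_of_tendsto_of_le_of_le tendsto_const_nhds
      (ENNReal.tendsto_atTop_zero_of_tsum_ne_top h.tsum_generationSum_lt_top.ne)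
      (fun _ => zero_le) hle
  have hg : Filter.Tendsto g Filter.atTop (nhds 0) := by
    simpa [ENNReal.rpow_rpow_inv hp.ne', hp] using hpow.ennrpow_const (1 - α⁻¹)⁻¹
  have hsub := ((ENNReal.tendsto_toReal ENNReal.zero_ne_top).comp hg).const_sub (lifetimeReal α ξ)
  rw [ENNReal.toReal_zero, sub_zero] at hsub
  exact hsub.congr fun n => (h.birth_spine_eq hα n).symm

lemma exists_birth_spine_le_lt (hα : α < 0) (h : Regular α ξ) {t : ℝ} (ht : 0 ≤ t)
    (ht' : t < lifetimeReal α ξ) :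
    ∃ n, birth α ξ (spine α ξ n) ≤ t ∧ t < birth α ξ (spine α ξ (n + 1)) := by
  classical
  have hex : ∃ n, t < birth α ξ (spine α ξ n) :=
    ((h.tendsto_birth_spine hα).eventually (lt_mem_nhds ht')).exists
  have hspec := Nat.find_spec hex
  obtain ⟨n, hn⟩ : ∃ n, Nat.find hex = n + 1 :=
    Nat.exists_eq_add_one_of_ne_zero fun hzero => ht.not_gt (by rwa [hzero] at hspec)
  rw [hn] at hspec
  exact ⟨n, not_lt.1 (Nat.find_min hex (by lia)), hspec⟩

end Regular

end Spine

section LastFragment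

variable {α : ℝ} {ξ : Marks}

/-- The value of `(Z 1, Θ 1, Δ 1)` if the masses of the first sub-blocks are `s`, and if the
`i`-th of them becomes extinct last, with `Z 1 = z`. -/
def stepAt (s : massPartitions) (i : ℕ) (z : ℝ) : ℝ × ℝ × (ℕ → ℝ) := (z, s.1 i, removeTerm s.1 i)

/-- The value of `(Z 1, Θ 1, Δ 1)`, as a function of the first split. -/
def firstStep (α : ℝ) (σ : Split) : ℝ × ℝ × (ℕ → ℝ) :=
  stepAt σ.1 (lastChild α σ) (lifetimeReal α (σ.2 (lastChild α σ)))

/-- The process `(Z n, Θ n, Δ n)` read along the spine: a measurable version of `chain`. -/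
def spineChain (α : ℝ) : ℕ → Marks → ℝ × ℝ × (ℕ → ℝ)
  | 0, ξ => (lifetimeReal α ξ, 1, 0)
  | n + 1, ξ => firstStep α (split (subtree (spine α ξ n) ξ))

lemma spineChain_fst (α : ℝ) (n : ℕ) (ξ : Marks) :
    (spineChain α n ξ).1 = lifetimeReal α (subtree (spine α ξ n) ξ) := by
  cases n with
  | zero => rw [spine, subtree_nil, spineChain]
  | succ n => rw [spine, subtree_cons]; rfl

namespace Regular

lemma residualExtinctionTime_eq (hα : α < 0) (h : Regular α ξ) {u : List ℕ} {t : ℝ}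
    (hu : Present α ξ u t) : residualExtinctionTime α ξ u t = deathTime α ξ u - t :=
  Fragmentation.residualExtinctionTime_eq hα h.clock_pos (mass_pos_of_present hα hu)
    (h.lifetime_lt_top u) hu.1 (hu.2.le.trans (splitTime_le_deathTime (h.lifetime_lt_top u)))

lemma extinctionTime_eq (hα : α < 0) (h : Regular α ξ) : extinctionTime α ξ = lifetimeReal α ξ :=
  extinctionTime_eq_lifetimeReal hα h.clock_pos (by simpa using h.lifetime_lt_top [])

lemma eq_spine_or_deathTime_lt_of_present (hα : α < 0) (h : Regular α ξ) {n : ℕ} {t : ℝ}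
    (hle : birth α ξ (spine α ξ n) ≤ t) (hlt : t < birth α ξ (spine α ξ (n + 1))) {v : List ℕ}
    (hv : Present α ξ v t) : v = spine α ξ n ∨ deathTime α ξ v < lifetimeReal α ξ := by
  rcases h.spine_suffix_or_eq_or_deathTime_lt hα n v with hsuffix | ⟨k, hk, rfl⟩ | hdeath
  · rcases eq_or_exists_append_cons_of_suffix hsuffix with rfl | ⟨w, i, rfl⟩
    · exact Or.inl rfl
    · have hbirth := birth_le_birth_append (α := α) h.clock_pos (i :: spine α ξ n) w
      exact absurd (hbirth.trans hv.1) hlt.not_ge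
  · have hmono : Monotone fun n => birth α ξ (spine α ξ n) :=
      monotone_nat_of_le_succ fun n => (h.birth_spine_lt_succ hα n).le
    exact absurd ((hmono (Nat.succ_le_of_lt hk)).trans hle) hv.2.not_ge
  · exact Or.inr hdeath

lemma isLastBlock_iff (hα : α < 0) (h : Regular α ξ) {n : ℕ} {t : ℝ}
    (hle : birth α ξ (spine α ξ n) ≤ t) (hlt : t < birth α ξ (spine α ξ (n + 1))) (u : List ℕ) :
    IsLastBlock α ξ t u ↔ u = spine α ξ n := by
  have hspine : Present α ξ (spine α ξ n) t := ⟨hle, hlt⟩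
  constructor
  · rintro ⟨hu, hmax⟩
    refine (h.eq_spine_or_deathTime_lt_of_present hα hle hlt hu).resolve_right fun hdeath => ?_
    have hres := hmax _ hspine
    rw [h.residualExtinctionTime_eq hα hspine, h.residualExtinctionTime_eq hα hu,
      h.deathTime_spine hα, sub_le_sub_iff_right] at hres
    exact hdeath.not_ge hres
  · rintro rfl
    refine ⟨hspine, fun v hv => ?_⟩
    rw [h.residualExtinctionTime_eq hα hspine, h.residualExtinctionTime_eq hα hv,
      h.deathTime_spine hα, sub_le_sub_iff_right]
    rcases h.eq_spine_or_deathTime_lt_of_present hα hle hlt hv with rfl | hdeath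
    exacts [(h.deathTime_spine hα n).le, hdeath.le]

lemma hasLastFragment (hα : α < 0) (h : Regular α ξ) : HasLastFragment α ξ := by
  intro t ht ht'
  rw [h.extinctionTime_eq hα] at ht'
  obtain ⟨n, hle, hlt⟩ := h.exists_birth_spine_le_lt hα ht ht'
  exact ⟨spine α ξ n, (h.isLastBlock_iff hα hle hlt _).2 rfl,
    fun v => (h.isLastBlock_iff hα hle hlt v).1⟩

lemma lastBlock_eq (hα : α < 0) (h : Regular α ξ) {n : ℕ} {t : ℝ}
    (hle : birth α ξ (spine α ξ n) ≤ t) (hlt : t < birth α ξ (spine α ξ (n + 1))) :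
    lastBlock α ξ t = spine α ξ n := by
  have hex : ∃ u, IsLastBlock α ξ t u := ⟨_, (h.isLastBlock_iff hα hle hlt _).2 rfl⟩
  rw [lastBlock, dif_pos hex]
  exact (h.isLastBlock_iff hα hle hlt _).1 hex.choose_spec

lemma lastFragment_eq (hα : α < 0) (h : Regular α ξ) {n : ℕ} {t : ℝ}
    (hle : birth α ξ (spine α ξ n) ≤ t) (hlt : t < birth α ξ (spine α ξ (n + 1))) :
    lastFragment α ξ t = mass ξ (spine α ξ n) := by
  have ht : t < extinctionTime α ξ :=
    (hlt.trans (h.birth_spine_lt hα _)).trans_eq (h.extinctionTime_eq hα).symm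
  rw [lastFragment, if_pos ⟨h.hasLastFragment hα, ht⟩, h.lastBlock_eq hα hle hlt]

lemma lastFragment_birth_spine (hα : α < 0) (h : Regular α ξ) (n : ℕ) :
    lastFragment α ξ (birth α ξ (spine α ξ n)) = mass ξ (spine α ξ n) :=
  h.lastFragment_eq hα le_rfl (h.birth_spine_lt_succ hα n)

lemma jumpTime_eq (hα : α < 0) (h : Regular α ξ) (n : ℕ) :
    jumpTime α ξ n = birth α ξ (spine α ξ n) := by
  induction n with
  | zero => rfl
  | succ n ih =>
    rw [jumpTime, ih, h.lastFragment_birth_spine hα]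
    refine IsLeast.csInf_eq ⟨⟨(h.birth_spine_lt_succ hα n).le, ?_⟩, ?_⟩
    · rw [h.lastFragment_birth_spine hα]
      exact h.mass_spine_succ_lt hα n
    · rintro t ⟨hle, hjump⟩
      by_contra! hlt
      exact hjump.ne (h.lastFragment_eq hα hle hlt)

lemma lastFragment_jumpTime (hα : α < 0) (h : Regular α ξ) (n : ℕ) :
    lastFragment α ξ (jumpTime α ξ n) = mass ξ (spine α ξ n) := by
  rw [h.jumpTime_eq hα, h.lastFragment_birth_spine hα]

lemma lastBlock_jumpTime (hα : α < 0) (h : Regular α ξ) (n : ℕ) :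
    lastBlock α ξ (jumpTime α ξ n) = spine α ξ n := by
  rw [h.jumpTime_eq hα]
  exact h.lastBlock_eq hα le_rfl (h.birth_spine_lt_succ hα n)

lemma Z_eq (hα : α < 0) (h : Regular α ξ) (n : ℕ) :
    Z α ξ n = lifetimeReal α (subtree (spine α ξ n) ξ) := by
  rw [Z, h.lastFragment_jumpTime hα, h.jumpTime_eq hα, h.extinctionTime_eq hα,
    ← h.deathTime_spine hα n, deathTime, add_sub_cancel_left, ← mul_assoc,
    ← Real.rpow_add (h.mass_spine_pos hα n), add_neg_cancel, Real.rpow_zero, one_mul]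

lemma Z_pos (hα : α < 0) (h : Regular α ξ) (n : ℕ) : 0 < Z α ξ n :=
  (h.lifetimeReal_pos _).trans_eq (h.Z_eq hα n).symm

lemma chain_eq (hα : α < 0) (h : Regular α ξ) (n : ℕ) : chain α ξ n = spineChain α n ξ := by
  refine Prod.ext ((h.Z_eq hα n).trans (spineChain_fst α n ξ).symm) ?_
  cases n with
  | zero => rfl
  | succ n =>
    have hratio (k : ℕ) : mass ξ (k :: spine α ξ n) / mass ξ (spine α ξ n) =
        (split (subtree (spine α ξ n) ξ)).1.1 k := by
      rw [mass_cons, mul_div_cancel_left₀ _ (h.mass_spine_pos hα n).ne']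
    simp only [chain, Θ, Δ, h.lastFragment_jumpTime hα, h.lastBlock_jumpTime hα, spine, hratio,
      List.headI_cons, spineChain, firstStep, stepAt]

end Regular

end LastFragment

section Measurability

lemma measurable_natSInf {E : Type*} [MeasurableSpace E] {p : E → ℕ → Prop}
    (hp : ∀ k, MeasurableSet {x | p x k}) : Measurable fun x => sInf {k | p x k} := by
  classical
  have hex (x : E) : ∃ k, p x k ∨ ∀ j, ¬ p x j := by
    by_cases h : ∃ k, p x k
    · exact h.imp fun k => Or.inl
    · exact ⟨0, Or.inr (not_exists.1 h)⟩
  have hfind (x : E) : sInf {k | p x k} = Nat.find (hex x) := by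
    rw [eq_comm, Nat.find_eq_iff]
    by_cases h : ∃ k, p x k
    · exact ⟨Or.inl (Nat.sInf_mem h), fun k hk hpk =>
        hpk.elim (Nat.notMem_of_lt_sInf hk) fun hall => hall _ h.choose_spec⟩
    · simp [not_exists.1 h]
  have hnone : MeasurableSet {x | ∀ j, ¬ p x j} := by
    simp only [Set.ofPred_forall]
    exact MeasurableSet.iInter fun j => (hp j).compl
  simp_rw [hfind]
  exact measurable_find hex fun k => (hp k).union hnone

variable {α : ℝ}

lemma measurable_lastChild : Measurable (lastChild α) :=
  measurable_natSInf fun _ => measurableSet_le (by fun_prop) (by fun_prop)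

lemma measurable_lastChild_apply {E : Type*} [MeasurableSpace E] {g : ℕ → Split → E}
    (hg : ∀ i, Measurable (g i)) : Measurable fun σ => g (lastChild α σ) σ :=
  (measurable_from_prod_countable_right (f := Function.uncurry g) hg).comp
    (measurable_lastChild.prodMk measurable_id)

@[fun_prop]
lemma measurable_stepAt (i : ℕ) :
    Measurable fun p : massPartitions × ℝ => stepAt p.1 i p.2 := by
  have hmass (k : ℕ) : Measurable fun p : massPartitions × ℝ => p.1.1 k :=
    (measurable_massPartitions_apply k).comp measurable_fst
  refine measurable_snd.prodMk ((hmass i).prodMk (measurable_pi_iff.2 fun j => ?_))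
  unfold removeTerm
  split_ifs
  exacts [hmass j, hmass (j + 1)]

lemma measurable_firstStep : Measurable (firstStep α) :=
  measurable_lastChild_apply
    (g := fun i (σ : Split) => stepAt σ.1 i (lifetimeReal α (σ.2 i))) fun i =>
      (measurable_stepAt i).comp (f := fun σ : Split => (σ.1, lifetimeReal α (σ.2 i)))
        (by fun_prop)

variable (α) in
/-- The first split of the sub-block of the initial block that becomes extinct last. -/
def nextSplit (σ : Split) : Split := split (σ.2 (lastChild α σ))

lemma measurable_nextSplit : Measurable (nextSplit α) :=
  measurable_lastChild_apply (g := fun i (σ : Split) => split (σ.2 i)) fun _ => by fun_prop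

variable (α) in
/-- The split of the `n`-th last block. -/
def spineSplit (n : ℕ) (ξ : Marks) : Split := split (subtree (spine α ξ n) ξ)

lemma spineSplit_succ (n : ℕ) (ξ : Marks) :
    spineSplit α (n + 1) ξ = nextSplit α (spineSplit α n ξ) := by
  rw [spineSplit, spine, subtree_cons]
  rfl

end Measurability

section ConditionalLaw

variable {α : ℝ} {ν : Measure massPartitions} [IsProbabilityMeasure ν]

variable (α ν) in
/-- The conditional law of the first split given that the extinction time is `x`. -/
def splitKernel : Kernel ℝ Split := tiltKernel (splitLaw ν) (residualReal α)

lemma isMarkovKernel_splitKernel (hα : α < 0) (hν : ν {s | (s : ℕ → ℝ) = Pi.single 0 1} = 0) :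
    IsMarkovKernel (splitKernel α ν) :=
  isMarkovKernel_tiltKernel (measurable_residualReal α) (tiltMass_residualReal_ne_zero hα hν)

variable (α ν) in
/-- The conditional law of the split of the `n`-th last block given `(Z n, Θ n, Δ n)`. -/
def stateKernel : Kernel (ℝ × ℝ × (ℕ → ℝ)) Split :=
  (splitKernel α ν).comap Prod.fst measurable_fst

lemma isMarkovKernel_stateKernel (hα : α < 0) (hν : ν {s | (s : ℕ → ℝ) = Pi.single 0 1} = 0) :
    IsMarkovKernel (stateKernel α ν) := by
  have := isMarkovKernel_splitKernel hα hν
  exact Kernel.IsMarkovKernel.comap _ measurable_fst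

lemma hasCondDistrib_split_lifetimeReal (hα : α < 0)
    (hν : ν {s | (s : ℕ → ℝ) = Pi.single 0 1} = 0) :
    HasCondDistrib split (lifetimeReal α) (splitKernel α ν) (marksLaw ν) := by
  have hsum := hasCondDistrib_exp_add (measurable_residualReal α) (residualReal_nonneg α)
    (tiltMass_residualReal_ne_zero hα hν)
  exact hasCondDistrib_congr
    (hasCondDistrib_comp_measurePreserving hsum (measurePreserving_clock_split ν))
    (lifetimeReal_ae_eq hα hν) Filter.EventuallyEq.rfl

end ConditionalLaw

section LastChildDecomposition

variable {α : ℝ} {ν : Measure massPartitions} [IsProbabilityMeasure ν]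

/-- If the lifetime of the `i`-th sub-block, rescaled to mass `1`, is `z`, then this sub-block
becomes extinct after all the others. -/
def Outlives (α : ℝ) (σ : Split) (i : ℕ) (z : ℝ) : Prop :=
  ∀ j, j ≠ i → branch α σ j < σ.1.1 i ^ (-α) * z

lemma measurableSet_outlives (α : ℝ) (i : ℕ) :
    MeasurableSet {p : Split × ℝ | Outlives α p.1 i p.2} := by
  simp only [Outlives, Set.ofPred_forall]
  exact MeasurableSet.iInter fun j => MeasurableSet.iInter fun _ =>
    measurableSet_lt (by fun_prop) (by fun_prop)

lemma outlives_resampleChild_iff {i : ℕ} {σ : Split} {ζ : Marks} {z : ℝ} :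
    Outlives α (resampleChild i (σ, ζ)) i z ↔ Outlives α σ i z :=
  forall₂_congr fun j hj => by
    rw [branch, resampleChild_snd_of_ne hj, resampleChild_fst]
    rfl

open Classical in
lemma lintegral_lastChild (hα : α < 0) (hν : ν {s | (s : ℕ → ℝ) = Pi.single 0 1} = 0)
    {ψ : ℕ → massPartitions × Marks → ℝ≥0∞} (hψ : ∀ i, Measurable (ψ i)) :
    ∫⁻ σ, ψ (lastChild α σ) (σ.1, σ.2 (lastChild α σ)) ∂splitLaw ν =
      ∑' i, ∫⁻ σ, ∫⁻ ζ, (if Outlives α σ i (lifetimeReal α ζ) then ψ i (σ.1, ζ) else 0)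
        ∂marksLaw ν ∂splitLaw ν := by
  have hm (i : ℕ) : Measurable fun p : Split × Marks =>
      if Outlives α p.1 i (lifetimeReal α p.2) then ψ i (p.1.1, p.2) else 0 :=
    Measurable.ite (measurableSet_outlives α i |>.preimage
      (f := fun p : Split × Marks => (p.1, lifetimeReal α p.2)) (by fun_prop))
      (by fun_prop) measurable_const
  have hresample (i : ℕ) := lintegral_resampleChild ν i (hm i) fun σ ζ ζ' => by
    simp only [outlives_resampleChild_iff, resampleChild_fst]
  simp_rw [← hresample]
  have hms (i : ℕ) : Measurable fun σ : Split =>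
      if Outlives α σ i (lifetimeReal α (σ.2 i)) then ψ i (σ.1, σ.2 i) else 0 :=
    (hm i).comp (by fun_prop : Measurable fun σ : Split => (σ, σ.2 i))
  rw [← lintegral_tsum fun i => (hms i).aemeasurable]
  refine lintegral_congr_ae ?_
  filter_upwards [ae_regularSplit hα hν] with σ h
  have hiff (i : ℕ) : Outlives α σ i (lifetimeReal α (σ.2 i)) ↔ i = lastChild α σ :=
    (h.lastChild_eq_iff hα).symm.trans eq_comm
  simp only [hiff]
  exact (tsum_ite_eq (lastChild α σ) fun i => ψ i (σ.1, σ.2 i)).symm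

lemma hasCondDistrib_nextSplit (hα : α < 0) (hν : ν {s | (s : ℕ → ℝ) = Pi.single 0 1} = 0) :
    HasCondDistrib (nextSplit α) (firstStep α) (stateKernel α ν) (splitLaw ν) := by
  classical
  have := isMarkovKernel_stateKernel hα hν
  have := isMarkovKernel_splitKernel hα hν
  rw [hasCondDistrib_iff_lintegral measurable_firstStep.aemeasurable
    measurable_nextSplit.aemeasurable]
  intro φ hφ
  have hκφ : Measurable fun y => ∫⁻ τ, φ (y, τ) ∂stateKernel α ν y :=
    hφ.lintegral_kernel_prod_right'
  have hstep (i : ℕ) : Measurable fun p : massPartitions × Marks =>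
      stepAt p.1 i (lifetimeReal α p.2) :=
    (measurable_stepAt i).comp (f := fun p : massPartitions × Marks => (p.1, lifetimeReal α p.2))
      (by fun_prop)
  have hleft := lintegral_lastChild hα hν
    (ψ := fun i p => φ (stepAt p.1 i (lifetimeReal α p.2), split p.2))
    fun i => hφ.comp ((hstep i).prodMk (by fun_prop))
  have hright := lintegral_lastChild hα hν
    (ψ := fun i p => ∫⁻ τ, φ (stepAt p.1 i (lifetimeReal α p.2), τ)
      ∂splitKernel α ν (lifetimeReal α p.2))
    fun i => hκφ.comp (hstep i)
  refine hleft.trans (Eq.trans (tsum_congr fun i => lintegral_congr fun σ => ?_) hright.symm)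
  have hout : MeasurableSet {z | Outlives α σ i z} :=
    (measurableSet_outlives α i).preimage measurable_prodMk_left
  have hcond := (hasCondDistrib_iff_lintegral (by fun_prop) (by fun_prop)).1
    (hasCondDistrib_split_lifetimeReal hα hν)
    (fun p => if Outlives α σ i p.1 then φ (stepAt σ.1 i p.1, p.2) else 0)
    (Measurable.ite (hout.preimage measurable_fst) (by fun_prop) measurable_const)
  refine hcond.trans (lintegral_congr fun ζ => ?_)
  split_ifs <;> simp

lemma hasCondDistrib_nextSplit_splitKernel (hα : α < 0)
    (hν : ν {s | (s : ℕ → ℝ) = Pi.single 0 1} = 0) (x : ℝ) :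
    HasCondDistrib (nextSplit α) (firstStep α) (stateKernel α ν) (splitKernel α ν x) := by
  have := isMarkovKernel_stateKernel hα hν
  set G : ℝ × ℝ × (ℕ → ℝ) → ℝ := fun y => y.2.1 ^ (-α) * y.1
  set w : ℝ × ℝ × (ℕ → ℝ) → ℝ≥0∞ := fun y => if 0 < x then
    (tiltMass (splitLaw ν) (residualReal α) x)⁻¹ * tiltWeight G x y else 1
  have hw : Measurable w := by
    have : Measurable (tiltWeight G x) := (measurable_tiltWeight (by fun_prop)).of_uncurry_left
    exact Measurable.ite (MeasurableSet.const _) (by fun_prop) measurable_const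
  have hkernel : splitKernel α ν x = (splitLaw ν).withDensity (w ∘ firstStep α) := by
    rw [splitKernel, tiltKernel_apply (measurable_residualReal α)]
    refine withDensity_congr_ae ?_
    filter_upwards [ae_regularSplit hα hν] with σ h
    have hG : G (firstStep α σ) = residualReal α σ := h.branch_lastChild hα
    simp only [w, Function.comp_apply, tiltWeight, hG]
  rw [hkernel]
  exact hasCondDistrib_withDensity_comp (hasCondDistrib_nextSplit hα hν) hw

end LastChildDecomposition

section SpineChain

variable {α : ℝ} {ν : Measure massPartitions} [IsProbabilityMeasure ν]

variable (α ν) in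
/-- The law of the next triple as a function of the current value of `Z`. -/
def stepKernel : Kernel ℝ (ℝ × ℝ × (ℕ → ℝ)) := (splitKernel α ν).map (firstStep α)

lemma isMarkovKernel_stepKernel (hα : α < 0) (hν : ν {s | (s : ℕ → ℝ) = Pi.single 0 1} = 0) :
    IsMarkovKernel (stepKernel α ν) := by
  have := isMarkovKernel_splitKernel hα hν
  exact Kernel.IsMarkovKernel.map _ measurable_firstStep

lemma hasCondDistrib_spineSplit_zero (hα : α < 0)
    (hν : ν {s | (s : ℕ → ℝ) = Pi.single 0 1} = 0) :
    HasCondDistrib (spineSplit α 0) (spineChain α 0) (stateKernel α ν) (marksLaw ν) := by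
  have := isMarkovKernel_stateKernel hα hν
  have hinit : Measurable fun z : ℝ => ((z, 1, 0) : ℝ × ℝ × (ℕ → ℝ)) := by fun_prop
  have hcond : HasCondDistrib (spineSplit α 0) (lifetimeReal α)
      ((stateKernel α ν).comap _ hinit) (marksLaw ν) := by
    have hkernel : (stateKernel α ν).comap _ hinit = splitKernel α ν := by ext1; rfl
    have hsplit : spineSplit α 0 = split := funext fun ξ => by
      rw [spineSplit, spine, subtree_nil]
    rw [hkernel, hsplit]
    exact hasCondDistrib_split_lifetimeReal hα hν
  exact HasCondDistrib.comp_right (hf := hinit) hcond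

lemma isMarkovChain_spineChain (hα : α < 0) (hν : ν {s | (s : ℕ → ℝ) = Pi.single 0 1} = 0) :
    IsMarkovChain (spineChain α) ((stepKernel α ν).comap Prod.fst measurable_fst)
      (marksLaw ν) := by
  have := isMarkovKernel_stateKernel hα hν
  have hchain := isMarkovChain_of_hasCondDistrib_state (S := spineSplit α) (Y := spineChain α)
    (measurable_firstStep (α := α)) measurable_nextSplit spineSplit_succ (fun _ _ => rfl)
    (hasCondDistrib_spineSplit_zero hα hν)
    fun y => hasCondDistrib_nextSplit_splitKernel hα hν y.1
  have hkernel : (stepKernel α ν).comap Prod.fst measurable_fst =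
      (stateKernel α ν).map (firstStep α) := by
    ext1 y
    rw [Kernel.comap_apply, stepKernel, stateKernel, Kernel.map_apply _ measurable_firstStep,
      Kernel.map_apply _ measurable_firstStep, Kernel.comap_apply]
  rwa [hkernel]

end SpineChain

section Transitions

variable {α : ℝ} {ν : Measure massPartitions} [IsProbabilityMeasure ν]

lemma rpow_neg_mul_lt_iff {a x y : ℝ} (ha : 0 < a) : a ^ (-α) * y < x ↔ y < a ^ α * x := by
  rw [Real.rpow_neg ha.le, inv_mul_lt_iff₀ (Real.rpow_pos_of_pos ha _)]

variable (α ν) in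
/-- The cumulative distribution function of the extinction time. -/
def lifetimeCdf (x : ℝ) : ℝ := (marksLaw ν).real {ζ | lifetimeReal α ζ ≤ x}

lemma measureReal_lifetimeReal_lt (hα : α < 0) (hν : ν {s | (s : ℕ → ℝ) = Pi.single 0 1} = 0)
    (x : ℝ) : (marksLaw ν).real {ζ | lifetimeReal α ζ < x} = lifetimeCdf α ν x := by
  have hne : ∀ᵐ ζ ∂marksLaw ν, lifetimeReal α ζ ≠ x := by
    simpa [ae_iff] using measure_lifetimeReal_eq hα hν x
  refine measureReal_congr ?_
  filter_upwards [hne] with ζ h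
  exact propext h.le_iff_lt.symm

lemma measureReal_rpow_neg_mul_lifetimeReal_lt (hα : α < 0)
    (hν : ν {s | (s : ℕ → ℝ) = Pi.single 0 1} = 0) {a z : ℝ} (ha : 0 ≤ a) (hz : 0 < z) :
    (marksLaw ν).real {ζ | a ^ (-α) * lifetimeReal α ζ < z} =
      if 0 < a then lifetimeCdf α ν (a ^ α * z) else 1 := by
  rcases ha.eq_or_lt with rfl | ha
  · simp [Real.zero_rpow (neg_pos.2 hα).ne', hz]
  · simp only [rpow_neg_mul_lt_iff ha, measureReal_lifetimeReal_lt hα hν, if_pos ha]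

lemma measureReal_outlives (hα : α < 0) (hν : ν {s | (s : ℕ → ℝ) = Pi.single 0 1} = 0)
    {s : massPartitions} {i : ℕ} {y : ℝ} (hs : 0 < s.1 i) (hy : 0 < y) :
    (Measure.infinitePi fun _ : ℕ => marksLaw ν).real {c | Outlives α (s, c) i y} =
      ∏' j : ℕ, if j ≠ i ∧ 0 < s.1 j then
        lifetimeCdf α ν (s.1 j ^ α * s.1 i ^ (-α) * y) else 1 := by
  have hpi : {c : ℕ → Marks | Outlives α (s, c) i y} = Set.univ.pi fun j =>
      {ζ | j ≠ i → s.1 j ^ (-α) * lifetimeReal α ζ < s.1 i ^ (-α) * y} := by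
    ext c
    simp [Outlives, branch]
  have hm (j : ℕ) : MeasurableSet
      {ζ | j ≠ i → s.1 j ^ (-α) * lifetimeReal α ζ < s.1 i ^ (-α) * y} :=
    (MeasurableSet.const _).imp (measurableSet_lt (by fun_prop) measurable_const)
  have hz : 0 < s.1 i ^ (-α) * y := mul_pos (Real.rpow_pos_of_pos hs _) hy
  rw [hpi, measureReal_infinitePi_pi_univ _ hm]
  refine tprod_congr fun j => ?_
  by_cases hj : j = i
  · simp [hj]
  · simp [hj, mul_assoc, measureReal_rpow_neg_mul_lifetimeReal_lt hα hν (s.2.2.1 j) hz]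

open Classical in
/-- The tilting weight of a split whose `i`-th sub-block has the lifetime `y` (rescaled to mass
`1`) and becomes extinct last; `0` if it does not become extinct last. -/
def lastWeight (α x : ℝ) (i : ℕ) (σ : Split) (y : ℝ) : ℝ≥0∞ :=
  if Outlives α σ i y then tiltWeight id x (σ.1.1 i ^ (-α) * y) else 0

lemma measurable_lastWeight (x : ℝ) (i : ℕ) :
    Measurable fun p : Split × ℝ => lastWeight α x i p.1 p.2 :=
  Measurable.ite (measurableSet_outlives α i)
    ((measurable_tiltWeight measurable_id).of_uncurry_left.comp (by fun_prop)) measurable_const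

lemma lastWeight_eq_zero (hα : α < 0) {x : ℝ} {i : ℕ} {σ : Split} (hs : σ.1.1 i = 0) (y : ℝ) :
    lastWeight α x i σ y = 0 := by
  refine if_neg fun h => (h (i + 1) (by omega)).not_ge ?_
  rw [hs, Real.zero_rpow (neg_pos.2 hα).ne', zero_mul]
  exact mul_nonneg (Real.rpow_nonneg (σ.1.2.2.1 _) _) (lifetimeReal_nonneg α _)

lemma lintegral_lastWeight (hα : α < 0) (hν : ν {s | (s : ℕ → ℝ) = Pi.single 0 1} = 0)
    (x : ℝ) (i : ℕ) (s : massPartitions) {y : ℝ} (hy : 0 < y) :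
    ∫⁻ c, lastWeight α x i (s, c) y ∂(Measure.infinitePi fun _ => marksLaw ν) =
      if 0 < s.1 i ∧ 0 < y ∧ y < s.1 i ^ α * x then
        ENNReal.ofReal (Real.exp (s.1 i ^ (-α) * y) * ∏' j : ℕ, if j ≠ i ∧ 0 < s.1 j then
          lifetimeCdf α ν (s.1 j ^ α * s.1 i ^ (-α) * y) else 1)
      else 0 := by
  rcases (s.2.2.1 i).eq_or_lt with hs | hs
  · have hzero (c : ℕ → Marks) : lastWeight α x i (s, c) y = 0 :=
      lastWeight_eq_zero hα hs.symm y
    simp [hzero, ← hs]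
  have hout : MeasurableSet {c : ℕ → Marks | Outlives α (s, c) i y} :=
    (measurableSet_outlives α i).preimage (f := fun c : ℕ → Marks => ((s, c), y)) (by fun_prop)
  have hlt : s.1 i ^ (-α) * y < x ↔ y < s.1 i ^ α * x := rpow_neg_mul_lt_iff hs
  have hind (c : ℕ → Marks) : lastWeight α x i (s, c) y =
      {c | Outlives α (s, c) i y}.indicator (fun _ => tiltWeight id x (s.1 i ^ (-α) * y)) c := rfl
  simp_rw [hind]
  rw [lintegral_indicator_const hout, ← ofReal_measureReal, measureReal_outlives hα hν hs hy]
  by_cases hyx : y < s.1 i ^ α * x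
  · rw [tiltWeight, id, if_pos (hlt.2 hyx), if_pos ⟨hs, hy, hyx⟩,
      ENNReal.ofReal_mul (Real.exp_pos _).le]
  · rw [tiltWeight, id, if_neg (hlt.not.2 hyx), if_neg fun h => hyx h.2.2, zero_mul]

variable (α ν) in
/-- The unnormalised density, with respect to the law of the extinction time, of the law of
`Z (n + 1)` given `Z n = x`. -/
def stepWeight (x y : ℝ) : ℝ≥0∞ := ∫⁻ σ, ∑' i, lastWeight α x i σ y ∂splitLaw ν

lemma measurable_stepWeight (x : ℝ) : Measurable (stepWeight α ν x) :=
  (Measurable.tsum fun i => measurable_lastWeight (α := α) x i).lintegral_prod_left'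

lemma lintegral_stepWeight_mul (x : ℝ) {φ : ℝ → ℝ≥0∞} (hφ : Measurable φ) :
    ∫⁻ ζ, stepWeight α ν x (lifetimeReal α ζ) * φ (lifetimeReal α ζ) ∂marksLaw ν =
      ∑' i, ∫⁻ σ, ∫⁻ ζ, lastWeight α x i σ (lifetimeReal α ζ) * φ (lifetimeReal α ζ)
        ∂marksLaw ν ∂splitLaw ν := by
  have hφL : Measurable fun ζ => φ (lifetimeReal α ζ) := by fun_prop
  have hw (i : ℕ) : Measurable fun p : Split × Marks =>
      lastWeight α x i p.1 (lifetimeReal α p.2) :=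
    (measurable_lastWeight x i).comp
      (by fun_prop : Measurable fun p : Split × Marks => (p.1, lifetimeReal α p.2))
  have hwζ (i : ℕ) (ζ : Marks) : Measurable fun σ => lastWeight α x i σ (lifetimeReal α ζ) :=
    (hw i).comp measurable_prodMk_right
  have hswap (i : ℕ) := lintegral_lintegral_swap (μ := splitLaw ν) (ν := marksLaw ν)
    (f := fun σ ζ => lastWeight α x i σ (lifetimeReal α ζ) * φ (lifetimeReal α ζ))
    ((hw i).mul (hφL.comp measurable_snd)).aemeasurable
  simp_rw [hswap, lintegral_mul_const _ (hwζ _ _)]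
  have hwm (i : ℕ) : Measurable fun ζ =>
      (∫⁻ σ, lastWeight α x i σ (lifetimeReal α ζ) ∂splitLaw ν) * φ (lifetimeReal α ζ) :=
    (hw i).lintegral_prod_left'.mul hφL
  rw [← lintegral_tsum fun i => (hwm i).aemeasurable]
  refine lintegral_congr fun ζ => ?_
  rw [ENNReal.tsum_mul_right, stepWeight, lintegral_tsum fun i => (hwζ i ζ).aemeasurable]

lemma lintegral_tiltWeight_mul_lastChild (hα : α < 0)
    (hν : ν {s | (s : ℕ → ℝ) = Pi.single 0 1} = 0) (x : ℝ) {φ : ℝ → ℝ≥0∞} (hφ : Measurable φ) :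
    ∫⁻ σ, tiltWeight (residualReal α) x σ * φ (lifetimeReal α (σ.2 (lastChild α σ)))
        ∂splitLaw ν =
      ∫⁻ ζ, stepWeight α ν x (lifetimeReal α ζ) * φ (lifetimeReal α ζ) ∂marksLaw ν := by
  set ψ : ℕ → massPartitions × Marks → ℝ≥0∞ := fun i p =>
    tiltWeight id x (p.1.1 i ^ (-α) * lifetimeReal α p.2) * φ (lifetimeReal α p.2)
  have hψ (i : ℕ) : Measurable (ψ i) := by
    have hmass : Measurable fun p : massPartitions × Marks => p.1.1 i :=
      (measurable_massPartitions_apply i).comp measurable_fst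
    exact ((measurable_tiltWeight measurable_id).of_uncurry_left.comp (by fun_prop)).mul
      (by fun_prop)
  calc _ = ∫⁻ σ, ψ (lastChild α σ) (σ.1, σ.2 (lastChild α σ)) ∂splitLaw ν := by
        refine lintegral_congr_ae ?_
        filter_upwards [ae_regularSplit hα hν] with σ h
        simp only [ψ, tiltWeight, ← h.branch_lastChild hα]
        rfl
    _ = _ := by
        rw [lintegral_lastChild hα hν hψ, lintegral_stepWeight_mul x hφ]
        simp only [ψ, lastWeight, ite_mul, zero_mul]

lemma stepWeight_eq (hα : α < 0) (hν : ν {s | (s : ℕ → ℝ) = Pi.single 0 1} = 0)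
    (x : ℝ) {y : ℝ} (hy : 0 < y) : stepWeight α ν x y = ∫⁻ s, ∑' i,
      (if 0 < s.1 i ∧ 0 < y ∧ y < s.1 i ^ α * x then
        ENNReal.ofReal (Real.exp (s.1 i ^ (-α) * y) * ∏' j : ℕ, if j ≠ i ∧ 0 < s.1 j then
          lifetimeCdf α ν (s.1 j ^ α * s.1 i ^ (-α) * y) else 1)
      else 0) ∂ν := by
  have hw (i : ℕ) : Measurable fun σ : Split => lastWeight α x i σ y :=
    (measurable_lastWeight x i).comp measurable_prodMk_right
  rw [stepWeight, splitLaw, lintegral_prod _ (Measurable.tsum hw).aemeasurable]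
  refine lintegral_congr fun s => ?_
  have hws (i : ℕ) : Measurable fun c => lastWeight α x i (s, c) y :=
    (hw i).comp measurable_prodMk_left
  rw [lintegral_tsum fun i => (hws i).aemeasurable]
  exact tsum_congr fun i => lintegral_lastWeight hα hν x i s hy

lemma fst_stepKernel_eq_withDensity (hα : α < 0)
    (hν : ν {s | (s : ℕ → ℝ) = Pi.single 0 1} = 0) {x : ℝ} (hx : 0 < x) :
    (stepKernel α ν).fst x = ((marksLaw ν).map (lifetimeReal α)).withDensity fun y =>
      (tiltMass (splitLaw ν) (residualReal α) x)⁻¹ * stepWeight α ν x y := by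
  refine Measure.ext_of_lintegral _ fun φ hφ => ?_
  have hlast : ∀ σ, (firstStep α σ).1 = lifetimeReal α (σ.2 (lastChild α σ)) := fun _ => rfl
  have hfirst : Measurable fun σ => φ (firstStep α σ).1 :=
    hφ.comp (measurable_fst.comp measurable_firstStep)
  rw [Kernel.fst_apply, lintegral_map hφ measurable_fst, stepKernel,
    Kernel.map_apply _ measurable_firstStep, lintegral_map (by fun_prop) measurable_firstStep,
    splitKernel, lintegral_tiltKernel (measurable_residualReal α) hx hfirst]
  simp_rw [hlast]
  have hw := measurable_stepWeight (α := α) (ν := ν) x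
  have hwφ : Measurable fun ζ => stepWeight α ν x (lifetimeReal α ζ) * φ (lifetimeReal α ζ) :=
    (hw.mul hφ).comp (measurable_lifetimeReal α)
  rw [lintegral_tiltWeight_mul_lastChild hα hν x hφ,
    lintegral_withDensity_eq_lintegral_mul _ (hw.const_mul _) hφ,
    lintegral_map ((hw.const_mul _).mul hφ) (measurable_lifetimeReal α),
    ← lintegral_const_mul _ hwφ]
  exact lintegral_congr fun ζ => (mul_assoc _ _ _).symm

lemma ofReal_exp_div_mul (hα : α < 0) (hν : ν {s | (s : ℕ → ℝ) = Pi.single 0 1} = 0)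
    {x : ℝ} (hx : 0 < x) (y : ℝ) :
    ENNReal.ofReal (Real.exp (-x) / extinctionDensity α ν x * extinctionDensity α ν y) =
      (tiltMass (splitLaw ν) (residualReal α) x)⁻¹ *
        ENNReal.ofReal (extinctionDensity α ν y) := by
  have h0 := tiltMass_residualReal_ne_zero hα hν x hx
  have hratio : Real.exp (-x) / extinctionDensity α ν x =
      ((tiltMass (splitLaw ν) (residualReal α) x)⁻¹).toReal := by
    rw [extinctionDensity, tiltDensity, ENNReal.toReal_inv,
      div_mul_cancel_left₀ (Real.exp_ne_zero _)]
  rw [hratio, ENNReal.ofReal_mul ENNReal.toReal_nonneg,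
    ENNReal.ofReal_toReal (ENNReal.inv_ne_top.2 h0)]

lemma fst_stepKernel (hα : α < 0) (hν : ν {s | (s : ℕ → ℝ) = Pi.single 0 1} = 0)
    {x : ℝ} (hx : 0 < x) : (stepKernel α ν).fst x = volume.withDensity
      (transitionDensity α ν (extinctionDensity α ν) (lifetimeCdf α ν) x) := by
  have hf : Measurable fun y => ENNReal.ofReal (extinctionDensity α ν y) :=
    (measurable_tiltDensity (measurable_residualReal α)).ennreal_ofReal
  rw [fst_stepKernel_eq_withDensity hα hν hx, (hasLaw_lifetimeReal hα hν).map_eq,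
    ← withDensity_mul _ hf ((measurable_stepWeight x).const_mul _),
    ← withDensity_indicator measurableSet_Ioi]
  congr 1
  ext y
  rw [transitionDensity]
  by_cases hy : 0 < y
  · rw [Set.indicator_of_mem (Set.mem_Ioi.2 hy), ofReal_exp_div_mul hα hν hx, Pi.mul_apply,
      stepWeight_eq hα hν x hy, ← mul_assoc, mul_comm (ENNReal.ofReal _)]
  · simp [hy]

end Transitions

section Conclusion

variable {Ω Ω' E E' : Type*} [MeasurableSpace Ω] [MeasurableSpace Ω'] [MeasurableSpace E]
  [MeasurableSpace E'] {P : Measure Ω}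

lemma IsMarkovChain.congr {X Y : ℕ → Ω → E} {κ : Kernel E E} (h : IsMarkovChain X κ P)
    (hXY : ∀ n, X n =ᵐ[P] Y n) : IsMarkovChain Y κ P := fun n => by
  refine hasCondDistrib_congr (h n) ?_ (hXY (n + 1)).symm
  filter_upwards [ae_all_iff.2 hXY] with ω hω
  exact funext fun m => (hω m).symm

lemma IsMarkovChain.comp_measurePreserving {Q : Measure Ω'} {X : ℕ → Ω' → E} {κ : Kernel E E}
    (h : IsMarkovChain X κ Q) {T : Ω → Ω'} (hT : MeasurePreserving T P Q) :
    IsMarkovChain (fun n => X n ∘ T) κ P :=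
  fun n => hasCondDistrib_comp_measurePreserving (h n) hT

lemma IsMarkovChain.fst [IsProbabilityMeasure P] {X : ℕ → Ω → E × E'}
    {κ : Kernel E (E × E')} [IsMarkovKernel κ]
    (h : IsMarkovChain X (κ.comap Prod.fst measurable_fst) P) :
    IsMarkovChain (fun n ω => (X n ω).1) κ.fst P := fun n =>
  HasCondDistrib.comp_right (f := fun (w : Finset.Iic n → E × E') m => (w m).1)
    (hf := by fun_prop) (h n).fst

variable {α : ℝ} {ν : Measure massPartitions} [IsProbabilityMeasure ν]

lemma isMarkovChain_chain (hα : α < 0) (hν : ν {s | (s : ℕ → ℝ) = Pi.single 0 1} = 0) :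
    IsMarkovChain (fun n ξ => chain α ξ n) ((stepKernel α ν).comap Prod.fst measurable_fst)
      (marksLaw ν) :=
  (isMarkovChain_spineChain hα hν).congr fun n => by
    filter_upwards [ae_regular hα hν] with ξ h using (h.chain_eq hα n).symm

lemma extinctionTime_ae_eq (hα : α < 0) (hν : ν {s | (s : ℕ → ℝ) = Pi.single 0 1} = 0) :
    extinctionTime α =ᵐ[marksLaw ν] lifetimeReal α := by
  filter_upwards [ae_regular hα hν] with ξ h using h.extinctionTime_eq hα

lemma hasLaw_extinctionTime (hα : α < 0) (hν : ν {s | (s : ℕ → ℝ) = Pi.single 0 1} = 0) :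
    HasLaw (extinctionTime α) ((volume.restrict (Set.Ioi 0)).withDensity
      fun x => ENNReal.ofReal (extinctionDensity α ν x)) (marksLaw ν) :=
  (hasLaw_lifetimeReal hα hν).congr (extinctionTime_ae_eq hα hν)

lemma measureReal_extinctionTime_le (hα : α < 0)
    (hν : ν {s | (s : ℕ → ℝ) = Pi.single 0 1} = 0) {T : Ω → Marks}
    (hT : MeasurePreserving T P (marksLaw ν)) (x : ℝ) :
    P.real {ω | extinctionTime α (T ω) ≤ x} = lifetimeCdf α ν x := by
  have hm : MeasurableSet {ζ | lifetimeReal α ζ ≤ x} :=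
    measurableSet_le (by fun_prop) measurable_const
  rw [lifetimeCdf, ← hT.measureReal_preimage hm.nullMeasurableSet]
  refine measureReal_congr ?_
  filter_upwards [hT.quasiMeasurePreserving.ae (extinctionTime_ae_eq hα hν)] with ω h
  exact propext (iff_of_eq (congrArg (· ≤ x) h))

omit [IsProbabilityMeasure ν] in
lemma measurePreserving_marks {ξ : List ℕ → Ω → ℝ × massPartitions}
    (hξ : ∀ u, Measurable (ξ u)) (hindep : iIndepFun ξ P)
    (hlaw : ∀ u, P.map (ξ u) = (expMeasure 1).prod ν) :
    MeasurePreserving (fun ω u => ξ u ω) P (marksLaw ν) := by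
  refine ⟨measurable_pi_iff.2 hξ, ?_⟩
  simp_rw [hindep.map_fun_eq_infinitePi_map hξ, hlaw]

end Conclusion

end Fragmentation

end

theorem mainTheorem5 (α : ℝ) (hα : α < 0)
    (ν : Measure Fragmentation.massPartitions) [IsProbabilityMeasure ν]
    (hν : ν {s | (s : ℕ → ℝ) = Pi.single 0 1} = 0)
    {Ω : Type*} [MeasurableSpace Ω] (P : Measure Ω) [IsProbabilityMeasure P]
    (ξ : List ℕ → Ω → ℝ × Fragmentation.massPartitions)
    (hξ_meas : ∀ u, Measurable (ξ u))
    (hξ_indep : iIndepFun ξ P)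
    (hξ_law : ∀ u, P.map (ξ u) = (expMeasure 1).prod ν) :
    -- the process `(Z n, Θ n, Δ n)`, its component `Z` and the extinction time
    let X : ℕ → Ω → ℝ × ℝ × (ℕ → ℝ) := fun n ω => Fragmentation.chain α (fun u => ξ u ω) n
    let Z : ℕ → Ω → ℝ := fun n ω => Fragmentation.Z α (fun u => ξ u ω) n
    let ζ : Ω → ℝ := fun ω => Fragmentation.extinctionTime α (fun u => ξ u ω)
    let Fζ : ℝ → ℝ := fun x => P.real {ω | ζ ω ≤ x}
    -- the continuous, strictly positive version of the density of `ζ` on `(0, ∞)`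
    ∃ fζ : ℝ → ℝ, ContinuousOn fζ (Set.Ioi 0) ∧ (∀ x, 0 < x → 0 < fζ x) ∧
      HasLaw ζ ((volume.restrict (Set.Ioi 0)).withDensity fun x => ENNReal.ofReal (fζ x)) P ∧
      -- a kernel giving the law of the next triple as a function of the current value of `Z`
      ∃ κ : Kernel ℝ (ℝ × ℝ × (ℕ → ℝ)), IsMarkovKernel κ ∧
        -- (a)
        Fragmentation.IsMarkovChain X (κ.comap Prod.fst measurable_fst) P ∧
        -- (b)
        (∀ n, ∀ᵐ ω ∂P, 0 < Z n ω) ∧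
        Fragmentation.IsMarkovChain Z κ.fst P ∧
        ∀ x, 0 < x →
          κ.fst x = volume.withDensity (Fragmentation.transitionDensity α ν fζ Fζ x) := by
  intro X Z ζ Fζ
  have hT := Fragmentation.measurePreserving_marks hξ_meas hξ_indep hξ_law
  have hFζ : Fζ = Fragmentation.lifetimeCdf α ν :=
    funext (Fragmentation.measureReal_extinctionTime_le hα hν hT)
  have hκ := Fragmentation.isMarkovKernel_stepKernel hα hν
  have hX : Fragmentation.IsMarkovChain X _ P :=
    (Fragmentation.isMarkovChain_chain hα hν).comp_measurePreserving hT
  have hZ_pos (n : ℕ) : ∀ᵐ ω ∂P, 0 < Z n ω :=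
    (hT.quasiMeasurePreserving.ae (Fragmentation.ae_regular hα hν)).mono
      fun _ h => h.Z_pos hα n
  refine ⟨Fragmentation.extinctionDensity α ν,
    Fragmentation.continuousOn_extinctionDensity hα hν,
    fun x hx => Fragmentation.extinctionDensity_pos hα hν hx,
    (Fragmentation.hasLaw_extinctionTime hα hν).comp hT.hasLaw,
    Fragmentation.stepKernel α ν, hκ, hX, hZ_pos, hX.fst, fun x hx => ?_⟩
  rw [hFζ]
  exact Fragmentation.fst_stepKernel hα hν hx
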